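/- Let $F$ be a field of characteristic not $2$. A quaternion algebra over $F$ is an $F$-algebra isomorphic to $\left(\frac{a,b}{F}\right)$ for some $a,b\in F^\times$; its norm form is $q_D=\langle 1,-a,-b,ab\rangle$. Two quaternion division algebras over the same field are called linked if they share a common maximal subfield (up to isomorphism over the base field), and isometric if their norm forms are isometric (equivalently, if they are isomorphic). There exists a field extension $L/F$ such that 1. $L/F$ is a linking extension: if $D,D'$ are quaternion division algebras over $F$ such that $D\otimes_F L$ and $D'\otimes_F L$ are division algebras, then $D\otimes_F L$ and $D'\otimes_F L$ are linked; 2. if $D,D'$ are linked, nonisometric quaternion division algebras over $F$, then $D\otimes_F L$ and $D'\otimes_F L$ are nonisometric quaternion division algebras over $L$; 3. $L$ is a transfinite tower of function fields: let $\mathscr P$ be the set of pairs $p=(D,D')$ of (isomorphism classes of) unlinked quaternion division algebras over $F$. For each $p=(D,D')\in\mathscr P$ the anisotropic part $\varphi_p$ of $q_D\perp -q_{D'}$ has dimension $6$, and there are a well-ordering $<$ of $\mathscr P$ and intermediate fields $F\subseteq F_p\subseteq L$ $(p\in\mathscr P)$ such that, with $F_{<p}:=F\cup\bigcup_{p'<p}F_{p'}$,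 the field $F_p$ contains $F_{<p}$ and is isomorphic over it to $\mathrm{Frac}\big(F_{<p}[x_1,\dots,x_6]/(\varphi_p)\big)$, and $L=F\cup\bigcup_{p\in\mathscr P}F_p$. -/

import Mathlib

open scoped Quaternion TensorProduct

universe u v

namespace Linking

section Algebras

variable (F : Type u) [Field F]

/-- The algebra `D` is represented by the Hilbert symbol `(a, b / F)`: it is the `F`-algebra with
basis `1, i, j, ij` and `i ^ 2 = a`, `j ^ 2 = b`, `ij = -ji`, where `a, b ≠ 0`. -/
def HasSymbol (D : Type v) [Ring D] [Algebra F D] (a b : Fˣ) : Prop :=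
  Nonempty (D ≃ₐ[F] ℍ[F, (a : F), 0, (b : F)])

/-- `D` is a quaternion algebra with center `F` (for `F` of characteristic not two). -/
def IsQuaternion (D : Type v) [Ring D] [Algebra F D] : Prop :=
  ∃ a b : Fˣ, HasSymbol F D a b

/-- `D` is a quaternion division algebra with center `F`. -/
def IsQuaternionDivision (D : Type v) [Ring D] [Algebra F D] : Prop :=
  IsQuaternion F D ∧ ∀ x : D, x ≠ 0 → IsUnit x

/-- `E` is a maximal element among the fields `E` with `F ⊆ E ⊆ D`. -/
def IsMaximalSubfield {D : Type v} [Ring D] [Algebra F D] (E : Subalgebra F D) : Prop :=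
  Maximal (fun S : Subalgebra F D => IsField S) E

/-- `D` and `D'` share a common maximal subfield (up to `F`-isomorphism). -/
def Linked (D D' : Type v) [Ring D] [Algebra F D] [Ring D'] [Algebra F D'] : Prop :=
  ∃ (E : Subalgebra F D) (E' : Subalgebra F D'),
    IsMaximalSubfield F E ∧ IsMaximalSubfield F E' ∧ Nonempty (E ≃ₐ[F] E')

variable {F} in
/-- The norm form `⟨1, -a⟩ ⊗ ⟨1, -b⟩ = ⟨1, -a, -b, ab⟩` of the quaternion algebra `(a, b / F)`. -/
noncomputable def normForm (a b : Fˣ) : QuadraticForm F (Fin 4 → F) :=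
  QuadraticMap.weightedSumSquares F ![(1 : F), -(a : F), -(b : F), (a : F) * (b : F)]

/-- The quaternion algebras `D` and `D'` have isometric norm forms. -/
def Isometric (D D' : Type v) [Ring D] [Algebra F D] [Ring D'] [Algebra F D'] : Prop :=
  ∃ a b a' b' : Fˣ, HasSymbol F D a b ∧ HasSymbol F D' a' b' ∧
    (normForm a b).Equivalent (normForm a' b')

/-- `L / F` is a linking extension: all division algebras among the `L ⊗ D`, for `D` a quaternion
division algebra with center `F`, are pairwise linked. -/
def IsLinkingExtension (L : Type u) [Field L] [Algebra F L] : Prop :=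
  ∀ (D D' : Type u) [Ring D] [Algebra F D] [Ring D'] [Algebra F D'],
    IsQuaternionDivision F D → IsQuaternionDivision F D' →
    IsQuaternionDivision L (L ⊗[F] D) → IsQuaternionDivision L (L ⊗[F] D') →
    Linked L (L ⊗[F] D) (L ⊗[F] D')

end Algebras

section Classes

variable (F : Type u) [Field F]

/-- Two Hilbert symbols are identified if their quaternion algebras are isomorphic. -/
def symbolSetoid : Setoid (Fˣ × Fˣ) where
  r s t := HasSymbol F ℍ[F, (s.1 : F), 0, (s.2 : F)] t.1 t.2
  iseqv :=
    { refl := fun _ => ⟨AlgEquiv.refl⟩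
      symm := fun ⟨e⟩ => ⟨e.symm⟩
      trans := fun ⟨e⟩ ⟨e'⟩ => ⟨e.trans e'⟩ }

/-- The set of isomorphism classes of quaternion algebras with center `F`. -/
def Quat : Type u := Quotient (symbolSetoid F)

variable {F}

/-- A Hilbert symbol representing the isomorphism class `D`. -/
noncomputable def Quat.symbol (D : Quat F) : Fˣ × Fˣ := Quotient.out D

/-- A quaternion algebra in the isomorphism class `D`. -/
abbrev Quat.Alg (D : Quat F) : Type u :=
  ℍ[F, (D.symbol.1 : F), 0, (D.symbol.2 : F)]

/-- The norm form of the isomorphism class `D`. -/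
noncomputable def Quat.form (D : Quat F) : QuadraticForm F (Fin 4 → F) :=
  normForm D.symbol.1 D.symbol.2

variable (F) in
/-- The set of pairs of unlinked (isomorphism classes of) quaternion division algebras. -/
def UnlinkedPair : Type u :=
  {p : Quat F × Quat F // IsQuaternionDivision F p.1.Alg ∧ IsQuaternionDivision F p.2.Alg ∧
    ¬ Linked F p.1.Alg p.2.Alg}

/-- The 6-dimensional form `φ` is the anisotropic part of `q_D - q_D'`: it is anisotropic, and
`q_D ⊥ -q_D'` is isometric to the sum of `φ` and a hyperbolic plane `⟨1, -1⟩`. -/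
def IsAnisotropicPart (D D' : Quat F) (φ : QuadraticForm F (Fin 6 → F)) : Prop :=
  φ.Anisotropic ∧
    (QuadraticMap.prod D.form (-D'.form)).Equivalent
      (QuadraticMap.prod φ (QuadraticMap.weightedSumSquares F ![(1 : F), -1]))

end Classes

section FunctionFields

variable {F : Type u} [Field F]

/-- The quadratic form `φ` as a homogeneous polynomial of degree two. -/
noncomputable def formPolynomial {r : ℕ} (φ : QuadraticForm F (Fin r → F)) :
    MvPolynomial (Fin r) F :=
  ∑ i, MvPolynomial.C (φ (Pi.single i 1)) * MvPolynomial.X i ^ 2 +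
    ∑ i, ∑ j ∈ Finset.Ioi i,
      MvPolynomial.C (QuadraticMap.polar φ (Pi.single i 1) (Pi.single j 1)) *
        (MvPolynomial.X i * MvPolynomial.X j)

/-- The "big" function field `K[φ] = Frac (K[x₁, …, x_r] / (φ))` over an extension `K` of `F`. -/
abbrev BigFunctionField (K : Type u) [Field K] [Algebra F K] {r : ℕ}
    (φ : QuadraticForm F (Fin r → F)) : Type u :=
  FractionRing (MvPolynomial (Fin r) K ⧸
    Ideal.span {MvPolynomial.map (algebraMap F K) (formPolynomial φ)})

/-- `L` is the union of a tower of fields `F_p` between `F` and `L`, indexed by the well-ordered set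
of unlinked pairs `p = (D, D')`, in which `F_p` is the function field, over the union of the `F_p'`
with `p' < p` (over `F`, if `p` is the least pair), of the 6-dimensional anisotropic part `φ_p` of
`q_D - q_D'`. The suprema are unions, as the `F_p` form a chain; if there are no unlinked pairs,
then `L = F`. -/
def IsFunctionFieldTower (F L : Type u) [Field F] [Field L] [Algebra F L] : Prop :=
  ∃ (lt : UnlinkedPair F → UnlinkedPair F → Prop)
    (φ : UnlinkedPair F → QuadraticForm F (Fin 6 → F))
    (K : UnlinkedPair F → IntermediateField F L),
    IsWellOrder (UnlinkedPair F) lt ∧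
    (∀ p, IsAnisotropicPart p.1.1 p.1.2 (φ p)) ∧
    (∀ p, ∃ h : (⨆ p' : {p' // lt p' p}, K p'.1) ≤ K p,
      Nonempty (IntermediateField.extendScalars h ≃ₐ[↥(⨆ p' : {p' // lt p' p}, K p'.1)]
        BigFunctionField ↥(⨆ p' : {p' // lt p' p}, K p'.1) (φ p))) ∧
    (⨆ p, K p) = ⊤

end FunctionFields

end Linking

/-!
Two quaternion division algebras `(a, b)` and `(a', b')` are linked if and only if their Albert form
`⟨-a, -b, ab, a', b', -a'b'⟩`, the difference of the pure parts of their norm forms, is isotropic.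
Hence `L` is obtained by adjoining a generic zero of the Albert form of every unlinked pair.

A norm form stays anisotropic over `L`: otherwise its pure part, of dimension three, would represent
a generic value of a diagonal form of dimension at least four, and the Cassels–Pfister theorem,
applied to one variable after the other, would give an isometric embedding of the latter into the
former. If `(α, β)` and `(α, γ)` are not isometric, then `(α, βγ)` is a division algebra and stays
one over `L`, so that `(α, β)` and `(α, γ)` remain nonisometric there.
-/

namespace Linking

section QuadraticForms

open QuadraticMap Polynomial

section Reflection

theorem polar_isometry_apply {R M N : Type*} [CommRing R] [AddCommGroup M] [AddCommGroup N]
    [Module R M] [Module R N] {Q : QuadraticForm R M} {Q' : QuadraticForm R N} (τ : Q →qᵢ Q')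
    (x y : M) : polar Q' (τ x) (τ y) = polar Q x y := by
  simp only [polar, ← _root_.map_add, QuadraticMap.Isometry.map_app]

variable {K V : Type*} [Field K] [AddCommGroup V] [Module K V]

theorem exists_isometry_apply_eq {Q : QuadraticForm K V} (hQ : Q.Anisotropic) {u v : V}
    (h : Q u = Q v) :
    ∃ τ : Q →qᵢ Q, τ u = v ∧ ∀ x, polar Q x (u - v) = 0 → τ x = x := by
  rcases eq_or_ne u v with rfl | huv
  · exact ⟨.id Q, rfl, fun _ _ => rfl⟩
  set r := u - v with hr
  have hr0 : Q r ≠ 0 := fun h0 => sub_ne_zero.mpr huv (hQ _ h0)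
  have hur : polar Q u r = Q r := by
    have hv : Q v = Q u + Q r - polar Q u r := by
      rw [show v = u + -r by rw [hr]; abel, QuadraticMap.map_add Q, QuadraticMap.map_neg,
        polar_neg_right]
      ring
    linear_combination h + hv
  refine ⟨⟨LinearMap.id - ((Q r)⁻¹ • Q.polarBilin r).smulRight r, fun x => ?_⟩, ?_,
    fun x hx => ?_⟩
  · change Q (x - ((Q r)⁻¹ * polar Q r x) • r) = Q x
    rw [sub_eq_add_neg, QuadraticMap.map_add Q, QuadraticMap.map_neg, QuadraticMap.map_smul,
      polar_neg_right, polar_smul_right, polar_comm Q r x, smul_eq_mul, smul_eq_mul]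
    field_simp
    ring
  · change u - ((Q r)⁻¹ * polar Q r u) • r = v
    rw [polar_comm, hur, inv_mul_cancel₀ hr0, one_smul, hr, sub_sub_cancel]
  · change x - ((Q r)⁻¹ * polar Q r x) • r = x
    rw [polar_comm, hx, mul_zero, zero_smul, sub_zero]

theorem exists_isometry_apply_eq_and_apply_eq {Q : QuadraticForm K V} (hQ : Q.Anisotropic)
    {u v u' v' : V} (hu : Q u = Q u') (hv : Q v = Q v') (huv : polar Q u v = polar Q u' v') :
    ∃ τ : Q →qᵢ Q, τ u = u' ∧ τ v = v' := by
  obtain ⟨ρ, hρ, -⟩ := exists_isometry_apply_eq hQ hu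
  obtain ⟨σ, hσ, hfix⟩ := exists_isometry_apply_eq hQ ((ρ.map_app v).trans hv)
  refine ⟨σ.comp ρ, ?_, hσ⟩
  have hpolar : polar Q u' (ρ v) = polar Q u' v' := by rw [← hρ, polar_isometry_apply, huv, hρ]
  rw [QuadraticMap.Isometry.comp_apply, hρ]
  exact hfix u' (by rw [polar_sub_right, hpolar, sub_self])

end Reflection

theorem exists_common_denominator {ι N : Type*} [Finite ι] (M : Type*) [CommRing M] [Nontrivial M]
    [CommRing N] [Algebra M N] [IsFractionRing M N] (v : ι → N) :
    ∃ b : M, b ≠ 0 ∧ ∃ p : ι → M, algebraMap M N ∘ p = algebraMap M N b • v := by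
  obtain ⟨b, hb⟩ := IsLocalization.exist_integer_multiples_of_finite (nonZeroDivisors M) v
  choose p hp using hb
  exact ⟨b, nonZeroDivisors.coe_ne_zero b, p, funext fun i => (hp i).trans (Algebra.smul_def _ _)⟩

section WeightedSumSquares

variable {ι K M N : Type*} [Fintype ι] [CommRing K] [CommRing M] [Algebra K M] [CommRing N]
  [Algebra K N]

theorem polar_weightedSumSquares (w : ι → K) (u v : ι → M) :
    polar (weightedSumSquares M w) u v = ∑ i, w i • (2 * (u i * v i)) := by
  simp only [polar, weightedSumSquares_apply, ← Finset.sum_sub_distrib, ← smul_sub, Pi.add_apply]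
  exact Finset.sum_congr rfl fun i _ => by ring_nf

theorem weightedSumSquares_single [DecidableEq ι] (w : ι → K) (i : ι) :
    weightedSumSquares K w (Pi.single i 1) = w i := by
  rw [weightedSumSquares_apply, Finset.sum_eq_single i (fun j _ hj => by simp [hj]) (by simp)]
  simp

theorem polar_weightedSumSquares_single [DecidableEq ι] (w : ι → K) (i : ι)
    (v : ι → K) : polar (weightedSumSquares K w) (Pi.single i 1) v = 2 * (w i * v i) := by
  rw [polar_weightedSumSquares, Finset.sum_eq_single i (fun j _ hj => by simp [hj]) (by simp),
    Pi.single_eq_same, one_mul, smul_eq_mul, mul_left_comm]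

theorem weightedSumSquares_comp (w : ι → K) (f : M →ₐ[K] N) (v : ι → M) :
    weightedSumSquares N w (f ∘ v) = f (weightedSumSquares M w v) := by
  simp

theorem polar_weightedSumSquares_comp (w : ι → K) (f : M →ₐ[K] N) (u v : ι → M) :
    polar (weightedSumSquares N w) (f ∘ u) (f ∘ v) = f (polar (weightedSumSquares M w) u v) := by
  simp [polar_weightedSumSquares, map_ofNat]

theorem weightedSumSquares_algebraMap [Algebra M N] [IsScalarTower K M N] (w : ι → K) :
    weightedSumSquares N (algebraMap K M ∘ w) = weightedSumSquares N w := by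
  ext v
  simp

theorem anisotropic_weightedSumSquares_of_injective {w : ι → K}
    (h : (weightedSumSquares N w).Anisotropic) (f : M →ₐ[K] N) (hf : Function.Injective f) :
    (weightedSumSquares M w).Anisotropic := fun v hv =>
  hf.comp_left <| (h (f ∘ v) (by rw [weightedSumSquares_comp, hv, map_zero])).trans
    (funext fun _ => (map_zero f).symm)

variable [IsDomain M] [Algebra M N] [IsFractionRing M N]

theorem anisotropic_weightedSumSquares_fractionRing [IsScalarTower K M N] {w : ι → K}
    (h : (weightedSumSquares M w).Anisotropic) : (weightedSumSquares N w).Anisotropic := by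
  intro v hv
  obtain ⟨b, hb, p, hp⟩ := exists_common_denominator M v
  have hinj := IsFractionRing.injective M N
  have hQp : weightedSumSquares M w p = 0 := hinj <| by
    rw [← IsScalarTower.toAlgHom_apply K M N, ← weightedSumSquares_comp,
      IsScalarTower.coe_toAlgHom', hp, QuadraticMap.map_smul, hv, smul_zero, map_zero]
  have : IsDomain N := IsFractionRing.isDomain M
  rw [h p hQp] at hp
  refine (smul_eq_zero.mp (hp.symm.trans (by ext; simp))).resolve_left ?_
  exact (map_ne_zero_iff _ hinj).mpr hb

end WeightedSumSquares

section Polynomial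

variable {ι K : Type*} [Fintype ι] [Field K] {w : ι → K}

theorem coeff_weightedSumSquares (w : ι → K) {v : ι → K[X]} {n : ℕ}
    (h : ∀ i, (v i).natDegree ≤ n) :
    (weightedSumSquares K[X] w v).coeff (2 * n) =
      weightedSumSquares K w fun i => (v i).coeff n := by
  simp [two_mul, coeff_mul_add_eq_of_natDegree_le (h _) (h _)]

theorem natDegree_weightedSumSquares (hw : (weightedSumSquares K w).Anisotropic) (v : ι → K[X]) :
    (weightedSumSquares K[X] w v).natDegree = 2 * Finset.univ.sup fun i => (v i).natDegree := by
  set n := Finset.univ.sup fun i => (v i).natDegree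
  have hle : ∀ i, (v i).natDegree ≤ n := fun i => Finset.le_sup (f := natDegree ∘ v) (by simp)
  refine le_antisymm ?_ ?_
  · rw [weightedSumSquares_apply]
    exact natDegree_sum_le_of_forall_le _ _ fun i _ => (natDegree_smul_le _ _).trans <|
      natDegree_mul_le.trans (by have := hle i; omega)
  rcases Nat.eq_zero_or_pos n with h0 | hpos
  · simp [h0]
  refine le_natDegree_of_ne_zero fun hcoeff => ?_
  rw [coeff_weightedSumSquares w hle] at hcoeff
  have hlt : ∀ i, (v i).natDegree < n := fun i =>
    (hle i).lt_of_ne fun hi => hpos.ne <| by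
      have hlead : (v i).leadingCoeff = 0 := by
        rw [leadingCoeff, hi]
        exact congrFun (hw _ hcoeff) i
      rw [← hi, leadingCoeff_eq_zero.mp hlead, natDegree_zero]
  exact ((Finset.sup_lt_iff hpos).mpr fun i _ => hlt i).ne rfl

theorem natDegree_le_of_natDegree_weightedSumSquares_le
    (hw : (weightedSumSquares K w).Anisotropic) {v : ι → K[X]} {n : ℕ}
    (h : (weightedSumSquares K[X] w v).natDegree ≤ 2 * n) (i : ι) : (v i).natDegree ≤ n := by
  rw [natDegree_weightedSumSquares hw] at h
  exact (Finset.le_sup (f := fun i => (v i).natDegree) (Finset.mem_univ i)).trans (by omega)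

theorem anisotropic_weightedSumSquares_polynomial (hw : (weightedSumSquares K w).Anisotropic) :
    (weightedSumSquares K[X] w).Anisotropic := by
  intro v hv
  have hdeg := natDegree_le_of_natDegree_weightedSumSquares_le hw (v := v) (n := 0) (by simp [hv])
  have hcoeff := hw _ ((coeff_weightedSumSquares w hdeg).symm.trans (by simp [hv]))
  ext1 i
  rw [eq_C_of_natDegree_le_zero (hdeg i), congrFun hcoeff i, Pi.zero_apply, C_0, Pi.zero_apply]

theorem anisotropic_weightedSumSquares_ratFunc (hw : (weightedSumSquares K w).Anisotropic) :
    (weightedSumSquares (RatFunc K) w).Anisotropic :=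
  anisotropic_weightedSumSquares_fractionRing (anisotropic_weightedSumSquares_polynomial hw)

theorem degree_polar_lt (w : ι → K) {r : ι → K[X]} {d : K[X]} (hd : d ≠ 0)
    (hr : ∀ i, (r i).degree < d.degree) (s : ι → K) :
    (polar (weightedSumSquares K[X] w) r (C ∘ s)).degree < d.degree := by
  rw [degree_eq_natDegree hd] at hr ⊢
  rw [polar_weightedSumSquares, ← mem_degreeLT]
  refine Submodule.sum_mem _ fun i _ => Submodule.smul_mem _ _ ?_
  have hi := Submodule.smul_mem _ (2 * s i) (mem_degreeLT.mpr (hr i))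
  rwa [smul_eq_C_mul, C_mul, C_ofNat, mul_right_comm, mul_assoc] at hi

theorem natDegree_weightedSumSquares_lt (hw : (weightedSumSquares K w).Anisotropic)
    {r : ι → K[X]} {d : K[X]} (hr : ∀ i, (r i).degree < d.degree) (hr0 : r ≠ 0) :
    (weightedSumSquares K[X] w r).natDegree < 2 * d.natDegree := by
  have hlt : ∀ i, r i ≠ 0 → (r i).natDegree < d.natDegree := fun i hi =>
    natDegree_lt_natDegree hi (hr i)
  obtain ⟨i, hi⟩ := Function.ne_iff.mp hr0
  have hd : 0 < d.natDegree := pos_of_gt (hlt i hi)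
  rw [natDegree_weightedSumSquares hw]
  refine Nat.mul_lt_mul_of_pos_left ((Finset.sup_lt_iff hd).mpr fun j _ => ?_) two_pos
  by_cases hj : r j = 0
  · simpa [hj] using hd
  · exact hlt j hj

theorem exists_cassels_pfister_step (hw : (weightedSumSquares K w).Anisotropic) (S : Set (ι → K))
    {p d : K[X]} {f : ι → K[X]} (hd : d ≠ 0) (hf : weightedSumSquares K[X] w f = d ^ 2 * p)
    (hS : ∀ s ∈ S, polar (weightedSumSquares K[X] w) f (C ∘ s) = 0) (hdvd : ¬ ∀ i, d ∣ f i) :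
    ∃ (d' : K[X]) (f' : ι → K[X]), d' ≠ 0 ∧ d'.natDegree < d.natDegree ∧
      weightedSumSquares K[X] w f' = d' ^ 2 * p ∧
      ∀ s ∈ S, polar (weightedSumSquares K[X] w) f' (C ∘ s) = 0 := by
  set Q := weightedSumSquares K[X] w
  set g : ι → K[X] := fun i => f i / d
  set r : ι → K[X] := fun i => f i % d
  have hfgr : f = d • g + r := funext fun i => (EuclideanDomain.div_add_mod (f i) d).symm
  have hr : ∀ i, (r i).degree < d.degree := fun i => degree_mod_lt _ hd
  have hrd : r = f + -(d • g) := by rw [hfgr]; abel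
  have hr0 : r ≠ 0 := fun h => hdvd fun i => EuclideanDomain.mod_eq_zero.mp (congrFun h i)
  set d' := d * p - polar Q f g + d * Q g
  have hQr : Q r = d * d' := by
    rw [hrd, QuadraticMap.map_add Q, QuadraticMap.map_neg, QuadraticMap.map_smul, polar_neg_right,
      polar_smul_right, hf, smul_eq_mul, smul_eq_mul]
    ring
  have hd' : d' ≠ 0 := fun h =>
    hr0 (anisotropic_weightedSumSquares_polynomial hw r (by rw [hQr, h, mul_zero]))
  have hdeg : d'.natDegree < d.natDegree := by
    have := natDegree_weightedSumSquares_lt hw hr hr0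
    rw [show weightedSumSquares K[X] w r = d * d' from hQr, natDegree_mul hd hd'] at this
    omega
  have hg : ∀ s ∈ S, polar Q g (C ∘ s) = 0 := fun s hs => by
    have hrs := degree_polar_lt w hd hr s
    have : polar Q r (C ∘ s) = -(d * polar Q g (C ∘ s)) := by
      rw [hrd, polar_add_left, polar_neg_left, polar_smul_left, hS s hs, zero_add, smul_eq_mul]
    by_contra h0
    refine hrs.not_ge ?_
    rw [this, degree_neg]
    exact degree_le_mul_left _ h0
  refine ⟨d', (Q g - p) • f + (2 * p * d - polar Q f g) • g, hd', hdeg, ?_, fun s hs => ?_⟩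
  · rw [QuadraticMap.map_add Q, QuadraticMap.map_smul, QuadraticMap.map_smul, polar_smul_left,
      polar_smul_right, hf]
    simp only [smul_eq_mul, d']
    ring
  · rw [polar_add_left, polar_smul_left, polar_smul_left, hS s hs, hg s hs, smul_zero, smul_zero,
      add_zero]

theorem exists_polynomial_of_eq_sq_mul (hw : (weightedSumSquares K w).Anisotropic)
    (S : Set (ι → K)) {p d : K[X]} {f : ι → K[X]} (hd : d ≠ 0)
    (hf : weightedSumSquares K[X] w f = d ^ 2 * p)
    (hS : ∀ s ∈ S, polar (weightedSumSquares K[X] w) f (C ∘ s) = 0) :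
    ∃ g : ι → K[X], weightedSumSquares K[X] w g = p ∧
      ∀ s ∈ S, polar (weightedSumSquares K[X] w) g (C ∘ s) = 0 := by
  induction hn : d.natDegree using Nat.strong_induction_on generalizing d f with | _ n ih => ?_
  by_cases hdvd : ∀ i, d ∣ f i
  · choose g hg using hdvd
    have hfg : f = d • g := funext hg
    refine ⟨g, mul_left_cancel₀ (pow_ne_zero 2 hd) ?_, fun s hs => mul_left_cancel₀ hd ?_⟩
    · rw [← hf, hfg, QuadraticMap.map_smul, smul_eq_mul, pow_two]
    · rw [mul_zero, ← hS s hs, hfg, polar_smul_left, smul_eq_mul]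
  · obtain ⟨d', f', hd', hlt, hf', hS'⟩ := exists_cassels_pfister_step hw S hd hf hS hdvd
    exact ih _ (hn ▸ hlt) hd' hf' hS' rfl

theorem exists_polynomial_of_ratFunc (hw : (weightedSumSquares K w).Anisotropic)
    (S : Set (ι → K)) {p : K[X]} {v : ι → RatFunc K}
    (hv : weightedSumSquares (RatFunc K) w v = algebraMap K[X] (RatFunc K) p)
    (hS : ∀ s ∈ S, polar (weightedSumSquares (RatFunc K) w) v (algebraMap K _ ∘ s) = 0) :
    ∃ g : ι → K[X], weightedSumSquares K[X] w g = p ∧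
      ∀ s ∈ S, polar (weightedSumSquares K[X] w) g (C ∘ s) = 0 := by
  obtain ⟨d, hd, f, hf⟩ := exists_common_denominator K[X] v
  set φ := IsScalarTower.toAlgHom K K[X] (RatFunc K)
  have hφ : Function.Injective φ := IsFractionRing.injective K[X] (RatFunc K)
  have hf' : φ ∘ f = φ d • v := hf
  refine exists_polynomial_of_eq_sq_mul hw S hd (f := f) (hφ ?_) fun s hs => hφ ?_
  · rw [← weightedSumSquares_comp, hf', QuadraticMap.map_smul, hv, map_mul, map_pow, pow_two]
    rfl
  · have hs' : φ ∘ C ∘ s = algebraMap K (RatFunc K) ∘ s := funext fun i => φ.commutes (s i)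
    rw [← polar_weightedSumSquares_comp, hf', hs', polar_smul_left, hS s hs, smul_zero, map_zero]

end Polynomial

end QuadraticForms

section SubformTheorem

open QuadraticMap Polynomial

variable {ι K M : Type*} [Fintype ι] [Field K] [Field M] [Algebra K M] {w : ι → K}

/-- The form `⟨w⟩` represents `x` over `M` at a vector that is orthogonal to the vectors in `S`,
which have their entries in `K`. -/
def RepresentsOrthogonally (w : ι → K) (S : Set (ι → K)) (x : M) : Prop :=
  ∃ v : ι → M, weightedSumSquares M w v = x ∧
    ∀ s ∈ S, polar (weightedSumSquares M w) v (algebraMap K M ∘ s) = 0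

theorem representsOrthogonally_image_iff {N : Type*} [Field N] [Algebra K N] [Algebra M N]
    [IsScalarTower K M N] {S : Set (ι → K)} {x : N} :
    RepresentsOrthogonally (algebraMap K M ∘ w) ((algebraMap K M ∘ ·) '' S) x ↔
      RepresentsOrthogonally w S x := by
  simp only [RepresentsOrthogonally, weightedSumSquares_algebraMap, Set.forall_mem_image,
    ← Function.comp_assoc, ← RingHom.coe_comp, ← IsScalarTower.algebraMap_eq]

theorem RepresentsOrthogonally.of_ratFunc (hw : (weightedSumSquares K w).Anisotropic)
    {S : Set (ι → K)} {c : K} (h : RepresentsOrthogonally w S (algebraMap K (RatFunc K) c)) :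
    RepresentsOrthogonally w S c := by
  obtain ⟨v, hv, hS⟩ := h
  obtain ⟨g, hg, hgS⟩ := exists_polynomial_of_ratFunc hw S (p := C c) (hv.trans (by simp)) hS
  refine ⟨aeval (0 : K) ∘ g, by rw [weightedSumSquares_comp, hg, aeval_C]; rfl, fun s hs => ?_⟩
  have hs' : (algebraMap K K ∘ s) = aeval (0 : K) ∘ C ∘ s := by ext i; simp
  rw [hs', polar_weightedSumSquares_comp, hgS s hs, map_zero]

theorem polar_C_comp (w u v : ι → K) :
    polar (weightedSumSquares K[X] w) (C ∘ u) (C ∘ v) = C (polar (weightedSumSquares K w) u v) :=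
  polar_weightedSumSquares_comp w (Algebra.ofId K K[X]) u v

theorem RepresentsOrthogonally.exists_of_ratFunc_X_sq (hw : (weightedSumSquares K w).Anisotropic)
    {S : Set (ι → K)} {d e : K} (h : RepresentsOrthogonally w S
      (algebraMap K (RatFunc K) d * RatFunc.X ^ 2 + algebraMap K (RatFunc K) e)) :
    ∃ u v : ι → K, weightedSumSquares K w u = d ∧ weightedSumSquares K w v = e ∧
      polar (weightedSumSquares K w) v u = 0 ∧
      ∀ s ∈ S, polar (weightedSumSquares K w) u s = 0 ∧
        polar (weightedSumSquares K w) v s = 0 := by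
  obtain ⟨f, hf, hS⟩ := h
  obtain ⟨g, hg, hgS⟩ :=
    exists_polynomial_of_ratFunc hw S (p := C d * X ^ 2 + C e) (hf.trans (by simp)) hS
  have hdeg : ∀ i, (g i).natDegree ≤ 1 :=
    natDegree_le_of_natDegree_weightedSumSquares_le hw (by rw [hg]; compute_degree)
  set u := fun i => (g i).coeff 1
  set v := fun i => (g i).coeff 0
  have hguv : g = (X : K[X]) • C ∘ u + C ∘ v := funext fun i =>
    (eq_X_add_C_of_natDegree_le_one (hdeg i)).trans (by simp [u, v, mul_comm X])
  have hC : ∀ x : ι → K, weightedSumSquares K[X] w (C ∘ x) = C (weightedSumSquares K w x) :=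
    weightedSumSquares_comp w (Algebra.ofId K K[X])
  have hcoeff : C (weightedSumSquares K w u) * X ^ 2 + C (polar (weightedSumSquares K w) u v) * X +
      C (weightedSumSquares K w v) = C d * X ^ 2 + C e := by
    rw [← hg, hguv, QuadraticMap.map_add (weightedSumSquares _ _), QuadraticMap.map_smul,
      polar_smul_left, hC, hC, polar_C_comp, smul_eq_mul, smul_eq_mul]
    ring
  refine ⟨u, v, ?_, ?_, ?_, fun s hs => ?_⟩
  · simpa [coeff_X, coeff_C, -weightedSumSquares_apply] using congrArg (coeff · 2) hcoeff
  · simpa [-weightedSumSquares_apply] using congrArg (coeff · 0) hcoeff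
  · rw [polar_comm]
    simpa [coeff_X, coeff_C, -weightedSumSquares_apply] using congrArg (coeff · 1) hcoeff
  · have hs' := hgS s hs
    rw [hguv, polar_add_left, polar_smul_left, polar_C_comp, polar_C_comp] at hs'
    exact ⟨by simpa using congrArg (coeff · 1) hs', by simpa using congrArg (coeff · 0) hs'⟩

theorem algebraicIndependent_cons_X {n : ℕ} {t : Fin n → M} (ht : AlgebraicIndependent K t) :
    AlgebraicIndependent K
      (Fin.cons RatFunc.X (algebraMap M (RatFunc M) ∘ t) : Fin (n + 1) → RatFunc M) := by
  have hX : AlgebraicIndependent M fun _ : Unit => (RatFunc.X : RatFunc M) := by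
    rw [algebraicIndependent_unique_type_iff]
    exact RatFunc.transcendental_X
  have h := (ht.sumElim_comp hX).comp (Fin.cons (Sum.inl ()) Sum.inr : Fin (n + 1) → Unit ⊕ Fin n)
    (Fin.cons_injective_iff.mpr ⟨by simp, Sum.inr_injective⟩)
  convert h using 1
  funext i
  refine Fin.cases ?_ (fun i => ?_) i <;> simp

theorem RepresentsOrthogonally.insert_of_exists (hw : (weightedSumSquares M w).Anisotropic)
    {S : Set (ι → K)} {u v : ι → M}
    (hu : ∀ s ∈ S, polar (weightedSumSquares M w) u (algebraMap K M ∘ s) = 0)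
    (hv : ∀ s ∈ S, polar (weightedSumSquares M w) v (algebraMap K M ∘ s) = 0)
    (huv : polar (weightedSumSquares M w) v u = 0) {u₀ : ι → K}
    (hu₀ : weightedSumSquares M w u = weightedSumSquares M w (algebraMap K M ∘ u₀))
    (hu₀S : ∀ s ∈ S, polar (weightedSumSquares K w) u₀ s = 0) :
    RepresentsOrthogonally w (insert u₀ S) (weightedSumSquares M w v) := by
  obtain ⟨τ, hτu, hτ⟩ := exists_isometry_apply_eq hw hu₀
  refine ⟨τ v, τ.map_app v, Set.forall_mem_insert.mpr ⟨?_, fun s hs => ?_⟩⟩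
  · rw [← hτu, polar_isometry_apply, huv]
  · rw [← hτ (algebraMap K M ∘ s), polar_isometry_apply, hv s hs]
    have hu₀s := polar_weightedSumSquares_comp w (Algebra.ofId K M) u₀ s
    rw [hu₀S s hs, map_zero] at hu₀s
    rw [polar_sub_right, polar_comm, hu s hs, polar_comm, zero_sub, neg_eq_zero]
    exact hu₀s

theorem RepresentsOrthogonally.exists_insert_of_ratFunc
    (hw : (weightedSumSquares M w).Anisotropic) {S : Set (ι → K)} {d : K} {e : M}
    (hd : RepresentsOrthogonally w S (algebraMap K M d) → RepresentsOrthogonally w S d)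
    (h : RepresentsOrthogonally w S
      (algebraMap K (RatFunc M) d * RatFunc.X ^ 2 + algebraMap M (RatFunc M) e)) :
    ∃ u₀ : ι → K, weightedSumSquares K w u₀ = d ∧
      (∀ s ∈ S, polar (weightedSumSquares K w) u₀ s = 0) ∧
      RepresentsOrthogonally w (insert u₀ S) e := by
  rw [IsScalarTower.algebraMap_apply K M, ← representsOrthogonally_image_iff (M := M)] at h
  rw [← weightedSumSquares_algebraMap (M := M)] at hw
  obtain ⟨u, v, hu, rfl, hvu, hS⟩ := h.exists_of_ratFunc_X_sq hw
  simp only [Set.forall_mem_image, weightedSumSquares_algebraMap] at hw hu hvu hS ⊢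
  obtain ⟨u₀, rfl, hu₀S⟩ := hd ⟨u, hu, fun s hs => (hS hs).1⟩
  refine ⟨u₀, rfl, hu₀S, .insert_of_exists hw (fun s hs => (hS hs).1) (fun s hs => (hS hs).2) hvu
    ?_ hu₀S⟩
  rw [hu]
  exact (weightedSumSquares_comp w (Algebra.ofId K M) u₀).symm

theorem exists_generic_diagonal_value {K : Type u} [Field K] {w : ι → K}
    (hw : (weightedSumSquares K w).Anisotropic) {n : ℕ} (d : Fin n → K) :
    ∃ (M : Type u) (_ : Field M) (_ : Algebra K M) (t : Fin n → M), AlgebraicIndependent K t ∧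
      (weightedSumSquares M w).Anisotropic ∧
      (∀ (S : Set (ι → K)) (c : K),
        RepresentsOrthogonally w S (algebraMap K M c) → RepresentsOrthogonally w S c) ∧
      ∀ S : Set (ι → K), RepresentsOrthogonally w S (∑ i, algebraMap K M (d i) * t i ^ 2) →
        ∃ u : Fin n → ι → K, (∀ i, weightedSumSquares K w (u i) = d i) ∧
          (∀ i, ∀ s ∈ S, polar (weightedSumSquares K w) (u i) s = 0) ∧
          Pairwise fun i j => polar (weightedSumSquares K w) (u i) (u j) = 0 := by
  induction n with
  | zero =>
    exact ⟨K, inferInstance, inferInstance, Fin.elim0, algebraicIndependent_empty_type, hw,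
      fun _ _ h => h, fun _ _ => ⟨Fin.elim0, fun i => i.elim0, fun i => i.elim0, fun i => i.elim0⟩⟩
  | succ n ih =>
    obtain ⟨M, _, _, t, ht, hM, hdesc, hrep⟩ := ih (Fin.tail d)
    have hM' : (weightedSumSquares M (algebraMap K M ∘ w)).Anisotropic := by
      rwa [weightedSumSquares_algebraMap]
    refine ⟨RatFunc M, inferInstance, inferInstance, _, algebraicIndependent_cons_X ht, ?_,
      fun S c h => ?_, fun S h => ?_⟩
    · have := anisotropic_weightedSumSquares_ratFunc hM'
      rwa [weightedSumSquares_algebraMap] at this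
    · rw [IsScalarTower.algebraMap_apply K M (RatFunc M),
        ← representsOrthogonally_image_iff (M := M)] at h
      exact hdesc S c (representsOrthogonally_image_iff.mp (h.of_ratFunc hM'))
    · obtain ⟨u₀, hu₀, hu₀S, h'⟩ := RepresentsOrthogonally.exists_insert_of_ratFunc hM (hdesc S _)
        (d := d 0) (e := ∑ i, algebraMap K M (Fin.tail d i) * t i ^ 2) (by
          rw [Fin.sum_univ_succ] at h
          simpa only [map_sum, map_mul, map_pow, Fin.cons_zero, Fin.cons_succ,
            Function.comp_apply, Fin.tail, ← IsScalarTower.algebraMap_apply K M (RatFunc M)]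
            using h)
      obtain ⟨u, hu, huS, huu⟩ := hrep _ h'
      refine ⟨Fin.cons u₀ u, Fin.cases hu₀ hu, Fin.cases hu₀S fun i s hs =>
        huS i s (Set.mem_insert_of_mem _ hs), ?_⟩
      have hu₀u : ∀ i, polar (weightedSumSquares K w) (u i) u₀ = 0 := fun i =>
        huS i u₀ (Set.mem_insert _ _)
      refine Fin.cases (Fin.cases (fun h => (h rfl).elim) fun j _ => ?_) fun i =>
        Fin.cases (fun _ => hu₀u i) fun j hij => huu fun h => hij (congrArg _ h)
      exact (polar_comm _ _ _).trans (hu₀u j)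

theorem card_le_of_orthogonal (h2 : (2 : K) ≠ 0) {n : ℕ} {u : Fin n → ι → K}
    (hu : ∀ i, weightedSumSquares K w (u i) ≠ 0)
    (huu : Pairwise fun i j => polar (weightedSumSquares K w) (u i) (u j) = 0) :
    n ≤ Fintype.card ι := by
  have hli : LinearIndependent K u :=
    LinearMap.linearIndependent_of_isOrthoᵢ (B := (weightedSumSquares K w).polarBilin) huu
      fun i hi => hu i <| by
        have : polar (weightedSumSquares K w) (u i) (u i) = 0 := hi
        rw [polar_self, two_nsmul, ← two_mul] at this
        exact (mul_eq_zero.mp this).resolve_left h2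
  simpa using hli.fintype_card_le_finrank

/-- The diagonal form `⟨d⟩` evaluated at the variables. -/
noncomputable def diagPoly {n : ℕ} (d : Fin n → K) : MvPolynomial (Fin n) K :=
  ∑ i, MvPolynomial.C (d i) * MvPolynomial.X i ^ 2

theorem card_le_of_represents_diagPoly {K : Type u} [Field K] (h2 : (2 : K) ≠ 0) {w : ι → K}
    (hw : (weightedSumSquares K w).Anisotropic) {n : ℕ} {d : Fin n → K} (hd : ∀ i, d i ≠ 0)
    {p : ι → MvPolynomial (Fin n) K} {q : MvPolynomial (Fin n) K} (hq : q ≠ 0)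
    (h : weightedSumSquares (MvPolynomial (Fin n) K) w p = q ^ 2 * diagPoly d) :
    n ≤ Fintype.card ι := by
  obtain ⟨M, _, _, t, ht, -, -, hrep⟩ := exists_generic_diagonal_value hw d
  have hq' : MvPolynomial.aeval t q ≠ 0 := (map_ne_zero_iff _ ht).mpr hq
  have hdt : MvPolynomial.aeval t (diagPoly d) = ∑ i, algebraMap K M (d i) * t i ^ 2 := by
    simp [diagPoly]
  obtain ⟨u, hu, -, huu⟩ := hrep ∅ ⟨(MvPolynomial.aeval t q)⁻¹ • MvPolynomial.aeval t ∘ p, by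
    rw [QuadraticMap.map_smul, weightedSumSquares_comp, h, smul_eq_mul, map_mul, map_pow, hdt]
    field_simp, by simp⟩
  exact card_le_of_orthogonal h2 (fun i => by rw [hu]; exact hd i) huu

theorem anisotropic_weightedSumSquares_mvPolynomial {K : Type u} [Field K] {w : ι → K}
    (hw : (weightedSumSquares K w).Anisotropic) (n : ℕ) :
    (weightedSumSquares (MvPolynomial (Fin n) K) w).Anisotropic := by
  obtain ⟨M, _, _, t, ht, hM, -⟩ := exists_generic_diagonal_value hw (0 : Fin n → K)
  exact anisotropic_weightedSumSquares_of_injective hM (MvPolynomial.aeval t) ht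

end SubformTheorem

theorem two_ne_zero_of_algebra {K R : Type*} [Field K] [CommRing R] [Nontrivial R] [Algebra K R]
    (h2 : (2 : K) ≠ 0) : (2 : R) ≠ 0 := by
  rw [← map_ofNat (algebraMap K R) 2]
  exact (map_ne_zero _).mpr h2

section FunctionField

open MvPolynomial QuadraticMap

variable {K : Type u} {L : Type v} [Field K] [Field L] [Algebra K L] {n : ℕ}

theorem aeval_diagPoly (d : Fin n → K) (t : Fin n → L) :
    aeval t (diagPoly d) = ∑ i, algebraMap K L (d i) * t i ^ 2 := by
  simp [diagPoly]

theorem aeval_cons_rename (y : L) (t : Fin n → L) (p : MvPolynomial (Fin n) K) :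
    aeval (Fin.cons y t : Fin (n + 1) → L) (rename Fin.succ p) = aeval t p := by
  rw [aeval_rename]
  rfl

theorem exists_linear_mem_span {c : K} (hc : c ≠ 0) (d : Fin n → K)
    (p : MvPolynomial (Fin (n + 1)) K) : ∃ p₀ p₁ : MvPolynomial (Fin n) K,
      p - (rename Fin.succ p₀ + rename Fin.succ p₁ * X 0) ∈
        Ideal.span {C c * (X 0 ^ 2 - rename Fin.succ (diagPoly d))} := by
  have hP : X 0 ^ 2 - rename Fin.succ (diagPoly d) ∈
      Ideal.span {C c * (X 0 ^ 2 - rename Fin.succ (diagPoly d))} :=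
    Ideal.mem_span_singleton.mpr ⟨C c⁻¹, by
      rw [mul_right_comm, ← C_mul, mul_inv_cancel₀ hc, C_1, one_mul]⟩
  induction p using MvPolynomial.induction_on with
  | C x => exact ⟨C x, 0, by simp⟩
  | add p q hp hq =>
    obtain ⟨p₀, p₁, hp⟩ := hp
    obtain ⟨q₀, q₁, hq⟩ := hq
    refine ⟨p₀ + q₀, p₁ + q₁, ?_⟩
    convert Ideal.add_mem _ hp hq using 1
    simp only [_root_.map_add]
    ring
  | mul_X p i hp =>
    obtain ⟨p₀, p₁, hp⟩ := hp
    refine Fin.cases ?_ (fun i => ?_) i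
    · refine ⟨p₁ * diagPoly d, p₀, ?_⟩
      convert Ideal.add_mem _ (Ideal.mul_mem_right (X 0) _ hp)
        (Ideal.mul_mem_left _ (rename Fin.succ p₁) hP) using 1
      simp only [map_mul]
      ring
    · refine ⟨p₀ * X i, p₁ * X i, ?_⟩
      convert Ideal.mul_mem_right (X i.succ) _ hp using 1
      simp only [map_mul, rename_X]
      ring

theorem eq_zero_of_sq_eq_sq_mul_diagPoly (h2 : (2 : K) ≠ 0) (hn : 2 ≤ n) {d : Fin n → K}
    (hd : ∀ i, d i ≠ 0) {p q : MvPolynomial (Fin n) K} (h : p ^ 2 = q ^ 2 * diagPoly d) :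
    q = 0 := by
  by_contra hq
  have hw : (weightedSumSquares K fun _ : Unit => (1 : K)).Anisotropic := fun v hv => by
    ext; simpa using hv
  have := card_le_of_represents_diagPoly h2 hw hd hq (p := fun _ => p)
    (by rw [← h, pow_two]; simp)
  simp only [Fintype.card_unit] at this
  omega

section GenericZero

variable (h2 : (2 : K) ≠ 0) (hn : 2 ≤ n) {d : Fin n → K} (hd : ∀ i, d i ≠ 0) {t : Fin n → L}
  (ht : AlgebraicIndependent K t) {y : L} (hy : y ^ 2 = ∑ i, algebraMap K L (d i) * t i ^ 2)

include h2 hn hd ht hy in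
theorem eq_zero_of_aeval_add_mul_eq_zero {p q : MvPolynomial (Fin n) K}
    (h : aeval t p + aeval t q * y = 0) : p = 0 ∧ q = 0 := by
  have hq : q = 0 := by
    refine eq_zero_of_sq_eq_sq_mul_diagPoly h2 hn hd (p := p) (ht ?_)
    rw [map_mul, map_pow, map_pow, aeval_diagPoly, ← hy, eq_neg_of_add_eq_zero_left h]
    ring
  rw [hq, map_zero, zero_mul, add_zero] at h
  exact ⟨(map_eq_zero_iff _ ht).mp h, hq⟩

include hy in
theorem span_le_ker_aeval_cons (c : K) :
    Ideal.span {C c * (X 0 ^ 2 - rename Fin.succ (diagPoly d))} ≤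
      RingHom.ker (aeval (R := K) (Fin.cons y t : Fin (n + 1) → L)) := by
  rw [Ideal.span_singleton_le_iff_mem, RingHom.mem_ker, map_mul, map_sub, aeval_cons_rename,
    aeval_diagPoly, map_pow, aeval_X, Fin.cons_zero, hy, sub_self, mul_zero]

include hy in
theorem exists_aeval_cons_eq {c : K} (hc : c ≠ 0) (p : MvPolynomial (Fin (n + 1)) K) :
    ∃ p₀ p₁ : MvPolynomial (Fin n) K,
      aeval (Fin.cons y t : Fin (n + 1) → L) p = aeval t p₀ + aeval t p₁ * y ∧
      p - (rename Fin.succ p₀ + rename Fin.succ p₁ * X 0) ∈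
        Ideal.span {C c * (X 0 ^ 2 - rename Fin.succ (diagPoly d))} := by
  obtain ⟨p₀, p₁, hp⟩ := exists_linear_mem_span hc d p
  refine ⟨p₀, p₁, sub_eq_zero.mp ?_, hp⟩
  simpa only [RingHom.mem_ker, map_sub, _root_.map_add, map_mul, aeval_cons_rename, aeval_X,
    Fin.cons_zero] using span_le_ker_aeval_cons hy c hp

include h2 hn hd ht hy in
theorem ker_aeval_cons {c : K} (hc : c ≠ 0) :
    RingHom.ker (aeval (R := K) (Fin.cons y t : Fin (n + 1) → L)) =
      Ideal.span {C c * (X 0 ^ 2 - rename Fin.succ (diagPoly d))} := by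
  refine le_antisymm (fun p hp => ?_) (span_le_ker_aeval_cons hy c)
  obtain ⟨p₀, p₁, heq, hmem⟩ := exists_aeval_cons_eq hy hc p
  obtain ⟨h0, h1⟩ :=
    eq_zero_of_aeval_add_mul_eq_zero h2 hn hd ht hy (heq.symm.trans (RingHom.mem_ker.mp hp))
  simpa [h0, h1] using hmem

include hy in
theorem exists_eq_aeval_add_mul {z : L}
    (hz : z ∈ Algebra.adjoin K (Set.range (Fin.cons y t : Fin (n + 1) → L))) :
    ∃ p q : MvPolynomial (Fin n) K, z = aeval t p + aeval t q * y := by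
  rw [Algebra.adjoin_range_eq_range_aeval] at hz
  obtain ⟨p, rfl⟩ := hz
  obtain ⟨p₀, p₁, h, -⟩ := exists_aeval_cons_eq hy one_ne_zero p
  exact ⟨p₀, p₁, h⟩

include h2 hn hd ht hy in
theorem anisotropic_weightedSumSquares_adjoin_cons {ι : Type*} [Fintype ι] {w : ι → K}
    (hw : ∀ p q : ι → MvPolynomial (Fin n) K,
      weightedSumSquares (MvPolynomial (Fin n) K) w p +
        diagPoly d * weightedSumSquares (MvPolynomial (Fin n) K) w q = 0 →
      polar (weightedSumSquares (MvPolynomial (Fin n) K) w) p q = 0 → p = 0 ∧ q = 0) :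
    (weightedSumSquares (IntermediateField.adjoin K
      (Set.range (Fin.cons y t : Fin (n + 1) → L))) w).Anisotropic := by
  open scoped IntermediateField.algebraAdjoinAdjoin in
  refine anisotropic_weightedSumSquares_fractionRing
    (M := Algebra.adjoin K (Set.range (Fin.cons y t : Fin (n + 1) → L))) fun v hv => ?_
  choose p q hpq using fun i => exists_eq_aeval_add_mul hy (v i).2
  have hv' : weightedSumSquares L w (Subalgebra.val _ ∘ v) = 0 := by
    rw [weightedSumSquares_comp, hv, map_zero]
  rw [show Subalgebra.val _ ∘ v = aeval t ∘ p + y • (aeval t ∘ q) from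
      funext fun i => (hpq i).trans (by simp [mul_comm]),
    QuadraticMap.map_add (weightedSumSquares _ _), QuadraticMap.map_smul, polar_smul_right,
    weightedSumSquares_comp, weightedSumSquares_comp, polar_weightedSumSquares_comp, ← pow_two,
    hy, ← aeval_diagPoly] at hv'
  obtain ⟨h0, h1⟩ := eq_zero_of_aeval_add_mul_eq_zero h2 hn hd ht hy
    (p := weightedSumSquares (MvPolynomial (Fin n) K) w p +
      diagPoly d * weightedSumSquares (MvPolynomial (Fin n) K) w q)
    (q := polar (weightedSumSquares (MvPolynomial (Fin n) K) w) p q) (by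
      rw [_root_.map_add, map_mul, ← hv', smul_eq_mul, smul_eq_mul]
      ring)
  obtain ⟨rfl, rfl⟩ := hw p q h0 h1
  ext i
  simp [hpq]

end GenericZero

end FunctionField

section NormForm

open MvPolynomial QuadraticMap

/-- The coefficients of the norm form of the quaternion algebra with Hilbert symbol `(a, b)`. -/
def normCoeff {R : Type*} [CommRing R] (a b : R) : Fin 4 → R :=
  ![1, -a, -b, a * b]

theorem algebraMap_comp_normCoeff {K R : Type*} [CommRing K] [CommRing R] [Algebra K R] (a b : K) :
    algebraMap K R ∘ normCoeff a b = normCoeff (algebraMap K R a) (algebraMap K R b) := by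
  ext i
  fin_cases i <;> simp [normCoeff]

variable {K : Type u} {L : Type v} [Field K] [Field L] [Algebra K L] {n : ℕ} {a b : K}

theorem anisotropic_pure_of_normCoeff (h : (weightedSumSquares K (normCoeff a b)).Anisotropic) :
    (weightedSumSquares K ![a, b, -(a * b)]).Anisotropic := by
  intro x hx
  have h0 := h ![0, x 0, x 1, x 2] (by
    simp only [weightedSumSquares_apply, Fin.sum_univ_three, Fin.sum_univ_four, normCoeff,
      Matrix.cons_val, smul_eq_mul] at hx ⊢
    linear_combination -hx)
  ext i
  fin_cases i
  exacts [congrFun h0 1, congrFun h0 2, congrFun h0 3]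

/-- If `u` and `v` are viewed as quaternions, `x` is twice the pure part of `u * star v`. -/
theorem exists_pure_eq_polar_sq_sub {R : Type*} [CommRing R] [Algebra K R] (a b : K)
    (u v : Fin 4 → R) : ∃ x : Fin 3 → R,
      weightedSumSquares R ![a, b, -(a * b)] x =
        polar (weightedSumSquares R (normCoeff a b)) u v ^ 2 -
          4 * (weightedSumSquares R (normCoeff a b) u *
            weightedSumSquares R (normCoeff a b) v) := by
  let A := algebraMap K R a
  let B := algebraMap K R b
  refine ⟨![2 * (u 1 * v 0 - u 0 * v 1 + B * (u 2 * v 3 - u 3 * v 2)),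
    2 * (u 2 * v 0 - u 0 * v 2 - A * (u 1 * v 3 - u 3 * v 1)),
    2 * (u 3 * v 0 - u 0 * v 3 - u 1 * v 2 + u 2 * v 1)], ?_⟩
  simp only [polar_weightedSumSquares, weightedSumSquares_apply, Fin.sum_univ_three,
    Fin.sum_univ_four, normCoeff, Matrix.cons_val, Algebra.smul_def, map_neg, map_mul, map_one, A,
    B]
  ring

theorem anisotropic_normCoeff_adjoin_cons (h2 : (2 : K) ≠ 0)
    (h : (weightedSumSquares K (normCoeff a b)).Anisotropic) (hn : 4 ≤ n) {d : Fin n → K}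
    (hd : ∀ i, d i ≠ 0) {t : Fin n → L} (ht : AlgebraicIndependent K t) {y : L}
    (hy : y ^ 2 = ∑ i, algebraMap K L (d i) * t i ^ 2) :
    (weightedSumSquares (IntermediateField.adjoin K
      (Set.range (Fin.cons y t : Fin (n + 1) → L))) (normCoeff a b)).Anisotropic := by
  refine anisotropic_weightedSumSquares_adjoin_cons h2 (by omega) hd ht hy fun p q hpq hpol => ?_
  have hR := anisotropic_weightedSumSquares_mvPolynomial h n
  obtain rfl : q = 0 := by
    by_contra hq
    obtain ⟨x, hx⟩ := exists_pure_eq_polar_sq_sub a b p q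
    have hcard := card_le_of_represents_diagPoly h2 (anisotropic_pure_of_normCoeff h) hd
      (q := 2 * weightedSumSquares (MvPolynomial (Fin n) K) (normCoeff a b) q)
      (mul_ne_zero (two_ne_zero_of_algebra h2) fun h0 => hq (hR q h0)) (p := x) (by
        rw [hx, hpol, eq_neg_of_add_eq_zero_left hpq]
        ring)
    simp only [Fintype.card_fin] at hcard
    omega
  exact ⟨hR p (by simpa using hpq), rfl⟩

end NormForm

section BigFunctionField

open MvPolynomial QuadraticMap

variable {F K L : Type u} [Field F] [Field K] [Field L] [Algebra F K] [Algebra K L] {n : ℕ}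

theorem formPolynomial_weightedSumSquares (w : Fin n → F) :
    formPolynomial (weightedSumSquares F w) = diagPoly w := by
  simp only [formPolynomial, weightedSumSquares_single, polar_weightedSumSquares_single]
  rw [diagPoly, add_eq_left]
  refine Finset.sum_eq_zero fun i _ => Finset.sum_eq_zero fun j hj => ?_
  rw [Pi.single_eq_of_ne (Finset.mem_Ioi.mp hj).ne, mul_zero, mul_zero, C_0, zero_mul]

theorem map_diagPoly (w : Fin (n + 1) → F) (hw : w 0 ≠ 0) :
    MvPolynomial.map (algebraMap F K) (diagPoly w) =
      C (algebraMap F K (w 0)) * (X 0 ^ 2 - rename Fin.succ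
        (diagPoly fun i => algebraMap F K (-(w i.succ / w 0)))) := by
  have hw' : algebraMap F K (w 0) ≠ 0 := (map_ne_zero _).mpr hw
  simp only [diagPoly, map_sum, map_mul, map_pow, map_X, map_C, rename_X, rename_C]
  rw [Fin.sum_univ_succ, mul_sub, Finset.mul_sum, sub_eq_add_neg, ← Finset.sum_neg_distrib]
  congr 1
  refine Finset.sum_congr rfl fun i _ => ?_
  rw [← mul_assoc, ← C_mul, ← neg_mul, ← C_neg, ← mul_neg, ← map_neg, neg_neg, map_div₀,
    mul_div_cancel₀ _ hw']

theorem nonempty_adjoin_cons_algEquiv_bigFunctionField (h2 : (2 : K) ≠ 0) (hn : 2 ≤ n)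
    {w : Fin (n + 1) → F} (hw : ∀ i, w i ≠ 0) {t : Fin n → L} (ht : AlgebraicIndependent K t)
    {y : L} (hy : y ^ 2 = ∑ i, algebraMap K L (algebraMap F K (-(w i.succ / w 0))) * t i ^ 2) :
    Nonempty (IntermediateField.adjoin K (Set.range (Fin.cons y t : Fin (n + 1) → L)) ≃ₐ[K]
      BigFunctionField K (weightedSumSquares F w)) := by
  have hker : RingHom.ker (aeval (R := K) (Fin.cons y t : Fin (n + 1) → L)) =
      Ideal.span {MvPolynomial.map (algebraMap F K)
        (formPolynomial (weightedSumSquares F w))} := by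
    rw [formPolynomial_weightedSumSquares, map_diagPoly w (hw 0)]
    refine ker_aeval_cons h2 hn (fun i => ?_) ht hy ((map_ne_zero _).mpr (hw 0))
    exact (map_ne_zero _).mpr (neg_ne_zero.mpr (div_ne_zero (hw _) (hw 0)))
  let e : (MvPolynomial (Fin (n + 1)) K ⧸ Ideal.span {MvPolynomial.map (algebraMap F K)
        (formPolynomial (weightedSumSquares F w))}) ≃ₐ[K]
      Algebra.adjoin K (Set.range (Fin.cons y t : Fin (n + 1) → L)) :=
    ((Ideal.quotientEquivAlgOfEq K hker.symm).trans
      (Ideal.quotientKerEquivRange _)).trans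
      (Subalgebra.equivOfEq _ _ (Algebra.adjoin_range_eq_range_aeval K _).symm)
  open scoped IntermediateField.algebraAdjoinAdjoin in
  exact ⟨IsFractionRing.algEquivOfAlgEquiv e.symm⟩

end BigFunctionField

section Tower

open IntermediateField QuadraticMap

variable {F L P : Type u} [Field F] [Field L] [Algebra F L] {n : ℕ}

/-- Independent generic zeros `(yₚ, tₚ)` in `L` of the diagonal quadratic forms with coefficients
`wₚ`. The tower of their function fields is the chain of subfields of `L` that these generate. -/
structure GenericZeros (F L : Type u) [Field F] [Field L] [Algebra F L] {P : Type u} {n : ℕ}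
    (w : P → Fin (n + 1) → F) where
  t : P × Fin n → L
  y : P → L
  algebraicIndependent : AlgebraicIndependent F t
  sq_eq : ∀ p, y p ^ 2 = ∑ i, algebraMap F L (-(w p i.succ / w p 0)) * t (p, i) ^ 2

namespace GenericZeros

variable {w : P → Fin (n + 1) → F} (G : GenericZeros F L w)

/-- The coordinates of the zero with index `p`. -/
def coords (p : P) : Fin (n + 1) → L := Fin.cons (G.y p) fun i => G.t (p, i)

theorem weightedSumSquares_coords {p : P} (hw : w p 0 ≠ 0) :
    weightedSumSquares L (w p) (G.coords p) = 0 := by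
  have hy : w p 0 • (G.y p * G.y p) = -∑ i : Fin n, w p i.succ • (G.t (p, i) * G.t (p, i)) := by
    rw [← pow_two, G.sq_eq, Finset.smul_sum, ← Finset.sum_neg_distrib]
    refine Finset.sum_congr rfl fun i _ => ?_
    rw [← Algebra.smul_def, smul_smul, mul_neg, mul_div_cancel₀ _ hw, neg_smul, pow_two]
  rw [weightedSumSquares_apply, Fin.sum_univ_succ]
  exact (congrArg (· + _) hy).trans (neg_add_cancel _)

theorem coords_succ_ne_zero (p : P) (i : Fin n) : G.coords p i.succ ≠ 0 :=
  G.algebraicIndependent.ne_zero (p, i)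

/-- The field generated by the coordinates of the zeros with index in `A`. -/
def field (A : Set P) : IntermediateField F L := adjoin F (⋃ p ∈ A, Set.range (G.coords p))

theorem coords_mem_field {A : Set P} {p : P} (hp : p ∈ A) (i : Fin (n + 1)) :
    G.coords p i ∈ G.field A :=
  subset_adjoin F _ (Set.mem_biUnion hp ⟨i, rfl⟩)

theorem field_le_iff {A : Set P} {E : IntermediateField F L} :
    G.field A ≤ E ↔ ∀ p ∈ A, ∀ i, G.coords p i ∈ E := by
  simp [field, adjoin_le_iff, Set.range_subset_iff]

theorem field_mono {A B : Set P} (h : A ⊆ B) : G.field A ≤ G.field B :=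
  G.field_le_iff.mpr fun _ hp => G.coords_mem_field (h hp)

theorem isAlgebraic_of_mem_field {A : Set P} {x : L} (hx : x ∈ G.field A) :
    IsAlgebraic (adjoin F (G.t '' {q | q.1 ∈ A})) x := by
  set E := adjoin F (G.t '' {q | q.1 ∈ A})
  suffices hle : G.field A ≤ (algebraicClosure E L).restrictScalars F from
    mem_algebraicClosure_iff.mp (hle hx)
  refine G.field_le_iff.mpr fun p hp => ?_
  have ht : ∀ i, G.t (p, i) ∈ E := fun i => subset_adjoin F _ ⟨(p, i), hp, rfl⟩
  have hy : G.y p ^ 2 ∈ E := by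
    rw [G.sq_eq]
    exact sum_mem fun i _ => mul_mem (_root_.algebraMap_mem _ _) (pow_mem (ht i) 2)
  refine Fin.cases (mem_algebraicClosure_iff.mpr (IsAlgebraic.of_pow two_pos ?_))
    fun i => mem_algebraicClosure_iff.mpr ?_
  · exact isAlgebraic_algebraMap (A := L) (⟨_, hy⟩ : E)
  · exact isAlgebraic_algebraMap (A := L) (⟨_, ht i⟩ : E)

theorem adjoin_le_field (A : Set P) : adjoin F (G.t '' {q | q.1 ∈ A}) ≤ G.field A := by
  rw [adjoin_le_iff]
  rintro _ ⟨⟨p, i⟩, hp, rfl⟩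
  exact G.coords_mem_field hp i.succ

theorem algebraicIndependent_field {A : Set P} {p : P} (hp : p ∉ A) :
    AlgebraicIndependent (G.field A) fun i => G.t (p, i) := by
  set E := adjoin F (G.t '' {q | q.1 ∈ A})
  have hdisj : Disjoint {q : P × Fin n | q.1 ∈ A} {q : P × Fin n | q.1 = p} :=
    Set.disjoint_left.mpr fun q hq hq' => hp (hq' ▸ hq)
  have hE : AlgebraicIndependent E fun i => G.t (p, i) :=
    (algebraicIndependent_adjoin_iff.mpr (G.algebraicIndependent.adjoin_of_disjoint hdisj)).comp
      (fun i : Fin n => (⟨(p, i), rfl⟩ : {q : P × Fin n | q.1 = p})) fun i j hij => by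
        simpa using hij
  let := (inclusion (G.adjoin_le_field A)).toAlgebra
  have : IsScalarTower E (G.field A) L := IsScalarTower.of_algebraMap_eq fun _ => rfl
  have : Algebra.IsAlgebraic E (G.field A) :=
    ⟨fun x => (isAlgebraic_algebraMap_iff (algebraMap (G.field A) L).injective).mp
      (G.isAlgebraic_of_mem_field x.2)⟩
  exact hE.extendScalars (G.field A)

theorem restrictScalars_adjoin_coords (A : Set P) (p : P) :
    (adjoin (G.field A) (Set.range (G.coords p))).restrictScalars F = G.field (insert p A) := by
  rw [field, adjoin_adjoin_left, field, Set.biUnion_insert, Set.union_comm]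

section Nonzero

variable (h2 : (2 : F) ≠ 0) (hw : ∀ p i, w p i ≠ 0)
include h2 hw

theorem anisotropic_field_insert {a b : F} (hn : 4 ≤ n) {A : Set P} {p : P} (hp : p ∉ A)
    (h : (weightedSumSquares (G.field A) (normCoeff a b)).Anisotropic) :
    (weightedSumSquares (G.field (insert p A)) (normCoeff a b)).Anisotropic := by
  rw [← weightedSumSquares_algebraMap (M := G.field A), algebraMap_comp_normCoeff] at h
  have h' := anisotropic_normCoeff_adjoin_cons (two_ne_zero_of_algebra h2) h hn
    (d := fun i => algebraMap F (G.field A) (-(w p i.succ / w p 0)))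
    (fun i => (map_ne_zero _).mpr (neg_ne_zero.mpr (div_ne_zero (hw p i.succ) (hw p 0))))
    (G.algebraicIndependent_field hp) (G.sq_eq p)
  rw [← algebraMap_comp_normCoeff, weightedSumSquares_algebraMap] at h'
  rw [← restrictScalars_adjoin_coords]
  exact h'

theorem anisotropic_field_finset {a b : F} (hn : 4 ≤ n)
    (h : (weightedSumSquares F (normCoeff a b)).Anisotropic) (T : Finset P) :
    (weightedSumSquares (G.field T) (normCoeff a b)).Anisotropic := by
  classical
  induction T using Finset.induction_on with
  | empty =>
    have hbot : G.field ↑(∅ : Finset P) = ⊥ := by simp [field]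
    rw [hbot]
    exact anisotropic_weightedSumSquares_of_injective h (botEquiv F L).toAlgHom
      (botEquiv F L).injective
  | insert p T hp ih =>
    rw [Finset.coe_insert]
    exact G.anisotropic_field_insert h2 hw hn (by simpa using hp) ih

theorem anisotropic_of_field_univ_eq_top {a b : F} (hn : 4 ≤ n)
    (h : (weightedSumSquares F (normCoeff a b)).Anisotropic) (htop : G.field Set.univ = ⊤) :
    (weightedSumSquares L (normCoeff a b)).Anisotropic := by
  classical
  have hfin : ∀ x : L, ∃ T : Finset P, x ∈ G.field T := fun x => by
    have hx : x ∈ G.field Set.univ := htop ▸ mem_top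
    simp only [field, Set.biUnion_univ, adjoin_iUnion] at hx
    obtain ⟨T, hT⟩ := exists_finset_of_mem_iSup hx
    refine ⟨T, SetLike.le_def.mp (iSup₂_le fun p hp => ?_) hT⟩
    rw [adjoin_le_iff]
    rintro _ ⟨i, rfl⟩
    exact G.coords_mem_field (by simpa using hp) i
  intro v hv
  choose T hT using fun i => hfin (v i)
  have hsub : ∀ i, (T i : Set P) ⊆ Finset.univ.biUnion T := fun i =>
    Finset.coe_subset.mpr (Finset.subset_biUnion_of_mem T (Finset.mem_univ i))
  let v' : Fin 4 → G.field (Finset.univ.biUnion T) := fun i =>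
    ⟨v i, G.field_mono (hsub i) (hT i)⟩
  have hv' : v' = 0 := G.anisotropic_field_finset h2 hw hn h _ v' <|
    Subtype.ext ((weightedSumSquares_comp _ (G.field _).val v').symm.trans hv)
  exact funext fun i => congrArg Subtype.val (congrFun hv' i)

theorem exists_algEquiv_bigFunctionField (hn : 2 ≤ n) {A : Set P} {p : P} (hp : p ∉ A)
    {S K : IntermediateField F L} (hS : S = G.field A) (hK : K = G.field (insert p A)) :
    ∃ h : S ≤ K, Nonempty (extendScalars h ≃ₐ[S]
      BigFunctionField S (weightedSumSquares F (w p))) := by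
  subst hS hK
  have hle : G.field A ≤ G.field (insert p A) := G.field_mono (Set.subset_insert _ _)
  have hE : extendScalars hle = adjoin (G.field A) (Set.range (G.coords p)) :=
    restrictScalars_injective F <| by
      rw [extendScalars_restrictScalars, restrictScalars_adjoin_coords]
  obtain ⟨e⟩ := nonempty_adjoin_cons_algEquiv_bigFunctionField
    (two_ne_zero_of_algebra (R := G.field A) h2) hn (hw p) (G.algebraicIndependent_field hp)
    (G.sq_eq p)
  exact ⟨hle, ⟨(equivOfEq hE).trans e⟩⟩

end Nonzero

theorem iSup_field (B : Set P) (A : P → Set P) (hA : ∀ p ∈ B, p ∈ A p)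
    (hAB : ∀ p ∈ B, A p ⊆ B) : ⨆ p : B, G.field (A p) = G.field B := by
  refine le_antisymm (iSup_le fun p => G.field_mono (hAB p p.2)) ?_
  exact G.field_le_iff.mpr fun p hp i =>
    le_iSup (fun p : B => G.field (A p)) ⟨p, hp⟩ (G.coords_mem_field (hA p hp) i)

/-- The zeros, as elements of the field that they generate. -/
def restrict : GenericZeros F (G.field Set.univ) w where
  t q := ⟨G.t q, G.coords_mem_field (Set.mem_univ q.1) q.2.succ⟩
  y p := ⟨G.y p, G.coords_mem_field (Set.mem_univ p) 0⟩
  algebraicIndependent := AlgebraicIndependent.of_comp (G.field Set.univ).val G.algebraicIndependent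
  sq_eq p := (algebraMap (G.field Set.univ) L).injective <| by
    rw [map_pow, map_sum]
    refine (G.sq_eq p).trans (Finset.sum_congr rfl fun i _ => ?_)
    rw [map_mul, map_pow, ← IsScalarTower.algebraMap_apply]
    rfl

theorem restrict_field_univ : G.restrict.field Set.univ = ⊤ := by
  apply map_injective (G.field Set.univ).val
  change (adjoin F (⋃ p ∈ Set.univ, Set.range (G.restrict.coords p))).map _ = _
  rw [adjoin_map, ← AlgHom.fieldRange_eq_map, fieldRange_val]
  simp only [Set.image_iUnion, ← Set.range_comp]
  refine congrArg (adjoin F) (Set.iUnion₂_congr fun p _ => congrArg Set.range (funext fun i => ?_))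
  exact Fin.cases rfl (fun i => rfl) i

end GenericZeros

theorem exists_genericZeros (w : P → Fin (n + 1) → F) :
    ∃ (L : Type u) (_ : Field L) (_ : Algebra F L) (G : GenericZeros F L w),
      G.field Set.univ = ⊤ := by
  let E := FractionRing (MvPolynomial (P × Fin n) F)
  let f := (IsScalarTower.toAlgHom F E (AlgebraicClosure E)).comp
    (IsScalarTower.toAlgHom F (MvPolynomial (P × Fin n) F) E)
  have hf : Function.Injective f :=
    (algebraMap E (AlgebraicClosure E)).injective.comp (IsFractionRing.injective _ _)
  choose y hy using fun p => IsAlgClosed.exists_pow_nat_eq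
    (∑ i, algebraMap F _ (-(w p i.succ / w p 0)) * f (MvPolynomial.X (p, i)) ^ 2) two_pos
  let G : GenericZeros F (AlgebraicClosure E) w :=
    ⟨_, y, (MvPolynomial.algebraicIndependent_X (P × Fin n) F).map' hf, hy⟩
  exact ⟨_, inferInstance, inferInstance, G.restrict, G.restrict_field_univ⟩

end Tower

section Quaternion

open QuadraticMap

variable {K : Type u} [Field K] {a b a' b' : K}

/-- The reduced norm of the quaternion algebra with Hilbert symbol `(a, b)`. -/
def nrd (a b : K) : QuadraticForm K ℍ[K,a,0,b] :=
  (weightedSumSquares K (normCoeff a b)).comp (QuaternionAlgebra.linearEquivTuple a 0 b).toLinearMap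

theorem nrd_apply (q : ℍ[K,a,0,b]) :
    nrd a b q = q.re ^ 2 - a * q.imI ^ 2 - b * q.imJ ^ 2 + a * b * q.imK ^ 2 := by
  simp only [nrd, normCoeff, comp_apply, weightedSumSquares_apply, Fin.sum_univ_four,
    LinearEquiv.coe_coe, QuaternionAlgebra.coe_linearEquivTuple, QuaternionAlgebra.equivTuple_apply,
    Matrix.cons_val, smul_eq_mul]
  ring

theorem equivalent_nrd_weightedSumSquares (a b : K) :
    (nrd a b).Equivalent (weightedSumSquares K (normCoeff a b)) :=
  ⟨{ QuaternionAlgebra.linearEquivTuple a 0 b with map_app' := fun _ => rfl }⟩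

theorem anisotropic_nrd_iff :
    (nrd a b).Anisotropic ↔ (weightedSumSquares K (normCoeff a b)).Anisotropic := by
  let e := QuaternionAlgebra.linearEquivTuple a 0 b
  exact ⟨fun h v hv =>
    e.symm.map_eq_zero_iff.mp (h _ ((congrArg _ (e.apply_symm_apply v)).trans hv)),
    fun h q hq => e.map_eq_zero_iff.mp (h _ hq)⟩

theorem mul_star_eq_nrd (q : ℍ[K,a,0,b]) : q * star q = algebraMap K _ (nrd a b q) := by
  rw [QuaternionAlgebra.algebraMap_eq, nrd_apply]
  ext <;> simp <;> ring

theorem star_mul_eq_nrd (q : ℍ[K,a,0,b]) : star q * q = algebraMap K _ (nrd a b q) := by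
  rw [QuaternionAlgebra.algebraMap_eq, nrd_apply]
  ext <;> simp <;> ring

theorem mul_self_of_re_eq_zero {q : ℍ[K,a,0,b]} (hq : q.re = 0) :
    q * q = algebraMap K _ (-nrd a b q) := by
  have hstar : star q = -q := by ext <;> simp [hq]
  rw [map_neg, ← mul_star_eq_nrd, hstar, mul_neg, neg_neg]

theorem re_mul_comm (p q : ℍ[K,a,0,b]) : (p * q).re = (q * p).re := by
  simp only [QuaternionAlgebra.re_mul]
  ring

theorem re_eq_zero_of_anticomm (h2 : (2 : K) ≠ 0) {c : K} (hc : c ≠ 0) {p q : ℍ[K,a,0,b]}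
    (hq : q * q = algebraMap K _ c) (hpq : p * q = -(q * p)) : p.re = 0 := by
  have h : (p * (q * q)).re = -(p * (q * q)).re := by
    nth_rw 1 [← mul_assoc, hpq, neg_mul, QuaternionAlgebra.re_neg, re_mul_comm, ← mul_assoc,
      re_mul_comm]
  have h' : 2 * c * p.re = 0 := by
    rw [hq, ← Algebra.commutes, ← Algebra.smul_def, QuaternionAlgebra.re_smul, smul_eq_mul] at h
    linear_combination h
  exact (mul_eq_zero.mp h').resolve_left (mul_ne_zero h2 hc)

theorem re_algHom (h2 : (2 : K) ≠ 0) (ha : a ≠ 0) (hb : b ≠ 0)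
    (f : ℍ[K,a,0,b] →ₐ[K] ℍ[K,a',0,b']) (q : ℍ[K,a,0,b]) : (f q).re = q.re := by
  have hii : f ⟨0, 1, 0, 0⟩ * f ⟨0, 1, 0, 0⟩ = algebraMap K _ a := by
    rw [← map_mul, ← f.commutes]
    congr 1
    ext <;> simp
  have hjj : f ⟨0, 0, 1, 0⟩ * f ⟨0, 0, 1, 0⟩ = algebraMap K _ b := by
    rw [← map_mul, ← f.commutes]
    congr 1
    ext <;> simp
  have hi : (f ⟨0, 1, 0, 0⟩).re = 0 := re_eq_zero_of_anticomm h2 hb hjj <| by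
    rw [← map_mul, ← map_mul, ← map_neg]
    congr 1
    ext <;> simp
  have hj : (f ⟨0, 0, 1, 0⟩).re = 0 := re_eq_zero_of_anticomm h2 ha hii <| by
    rw [← map_mul, ← map_mul, ← map_neg]
    congr 1
    ext <;> simp
  have hk : (f ⟨0, 0, 0, 1⟩).re = 0 := re_eq_zero_of_anticomm h2 ha hii <| by
    rw [← map_mul, ← map_mul, ← map_neg]
    congr 1
    ext <;> simp
  have hq : q = algebraMap K _ q.re + q.imI • ⟨0, 1, 0, 0⟩ + q.imJ • ⟨0, 0, 1, 0⟩ +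
      q.imK • ⟨0, 0, 0, 1⟩ := by
    ext <;> simp
  rw [hq]
  simp only [_root_.map_add, map_smul, AlgHom.commutes]
  simp [hi, hj, hk]

theorem nrd_algHom (h2 : (2 : K) ≠ 0) (ha : a ≠ 0) (hb : b ≠ 0)
    (f : ℍ[K,a,0,b] →ₐ[K] ℍ[K,a',0,b']) (q : ℍ[K,a,0,b]) : nrd a' b' (f q) = nrd a b q := by
  have hstar : ∀ {c d : K} (p : ℍ[K,c,0,d]), star p = algebraMap K _ (2 * p.re) - p := fun p => by
    rw [QuaternionAlgebra.algebraMap_eq]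
    ext <;> simp
    ring
  have hf : star (f q) = f (star q) := by
    rw [hstar, hstar, map_sub, AlgHom.commutes, re_algHom h2 ha hb]
  apply (algebraMap K ℍ[K,a',0,b']).injective
  rw [← mul_star_eq_nrd, hf, ← map_mul, mul_star_eq_nrd, AlgHom.commutes]

theorem imJ_eq_zero_and_imK_eq_zero_of_commute (h2 : (2 : K) ≠ 0) (ha : a ≠ 0) {q : ℍ[K,a,0,b]}
    (h : Commute ⟨0, 1, 0, 0⟩ q) : q.imJ = 0 ∧ q.imK = 0 := by
  have h' := QuaternionAlgebra.ext_iff.mp h.eq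
  simp only [QuaternionAlgebra.imJ_mul, QuaternionAlgebra.imK_mul] at h'
  refine ⟨mul_left_cancel₀ h2 ?_, mul_left_cancel₀ (mul_ne_zero h2 ha) ?_⟩
  · linear_combination h'.2.2.2
  · linear_combination h'.2.2.1

theorem mem_bot_of_im_eq_zero {q : ℍ[K,a,0,b]} (h : q.im = 0) : q ∈ (⊥ : Subalgebra K _) :=
  ⟨q.re, by simpa [h] using (QuaternionAlgebra.re_add_im q)⟩

theorem notMem_bot_of_re_eq_zero {q : ℍ[K,a,0,b]} (hq : q.re = 0) (hq0 : q ≠ 0) :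
    q ∉ (⊥ : Subalgebra K _) := by
  rintro ⟨r, rfl⟩
  obtain rfl : r = 0 := by simpa using hq
  exact hq0 (map_zero _)

theorem mem_bot_of_forall_commute (h2 : (2 : K) ≠ 0) (ha : a ≠ 0) {q : ℍ[K,a,0,b]}
    (h : ∀ p, Commute p q) : q ∈ (⊥ : Subalgebra K _) := by
  obtain ⟨hJ, hK⟩ := imJ_eq_zero_and_imK_eq_zero_of_commute h2 ha (h _)
  have hj := congrArg QuaternionAlgebra.imK (h ⟨0, 0, 1, 0⟩).eq
  have hI : q.imI = 0 := mul_left_cancel₀ h2 <| by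
    simp only [QuaternionAlgebra.imK_mul] at hj
    linear_combination -hj
  exact mem_bot_of_im_eq_zero (by ext <;> simp [hI, hJ, hK])

theorem algHom_injective (h2 : (2 : K) ≠ 0) (ha : a ≠ 0) (hb : b ≠ 0) {D : Type v} [Ring D]
    [Nontrivial D] [Algebra K D] (f : ℍ[K,a,0,b] →ₐ[K] D) : Function.Injective f := by
  have hre : ∀ q, f q = 0 → q.re = 0 := fun q hq => by
    have h : algebraMap K _ (2 * 2 * a * b * q.re) =
        (a * b) • q + b • (⟨0, 1, 0, 0⟩ * q * ⟨0, 1, 0, 0⟩) +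
          a • (⟨0, 0, 1, 0⟩ * q * ⟨0, 0, 1, 0⟩) - ⟨0, 0, 0, 1⟩ * q * ⟨0, 0, 0, 1⟩ := by
      rw [QuaternionAlgebra.algebraMap_eq]
      ext <;> simp <;> ring
    have h0 := congrArg f h
    simp only [map_sub, _root_.map_add, map_smul, map_mul f, hq, AlgHom.commutes, mul_zero,
      zero_mul, smul_zero, add_zero, sub_zero, map_eq_zero, mul_eq_zero] at h0
    simpa only [h2, ha, hb, false_or] using h0
  have hmul : ∀ q, f q = 0 → ∀ p, (q * p).re = 0 := fun q hq p =>
    hre _ (by rw [map_mul, hq, zero_mul])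
  refine (injective_iff_map_eq_zero f).mpr fun q hq => ?_
  have hi := hmul q hq ⟨0, 1, 0, 0⟩
  have hj := hmul q hq ⟨0, 0, 1, 0⟩
  have hk := hmul q hq ⟨0, 0, 0, 1⟩
  ext
  · exact hre q hq
  · simpa [ha] using hi
  · simpa [hb] using hj
  · simpa [ha, hb] using hk

end Quaternion

section Symbol

variable {K : Type u} [Field K] {D : Type v} [Ring D] [Algebra K D] {a b : Kˣ}

theorem exists_algEquiv_of_anticomm (h2 : (2 : K) ≠ 0) (hD : Module.finrank K D = 4) {x z : D}
    (hx : x * x = algebraMap K D a) (hz : z * z = algebraMap K D b) (hxz : x * z = -(z * x)) :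
    ∃ e : D ≃ₐ[K] ℍ[K,(a : K),0,(b : K)], e x = ⟨0, 1, 0, 0⟩ := by
  let B : QuaternionAlgebra.Basis D (a : K) 0 (b : K) :=
    { i := x
      j := z
      k := x * z
      i_mul_i := by rw [hx, zero_smul, add_zero, Algebra.algebraMap_eq_smul_one]
      j_mul_j := by rw [hz, Algebra.algebraMap_eq_smul_one]
      i_mul_j := rfl
      j_mul_i := by rw [hxz, zero_smul, zero_sub, neg_neg] }
  have : Nontrivial D := Module.nontrivial_of_finrank_pos (R := K) (by omega)
  have : FiniteDimensional K D := Module.finite_of_finrank_pos (by omega)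
  have hinj := algHom_injective h2 a.ne_zero b.ne_zero B.liftHom
  have hbij : Function.Bijective B.liftHom := ⟨hinj,
    (LinearMap.injective_iff_surjective_of_finrank_eq_finrank (f := B.liftHom.toLinearMap)
      (by rw [QuaternionAlgebra.finrank_eq_four, hD])).mp hinj⟩
  refine ⟨(AlgEquiv.ofBijective B.liftHom hbij).symm, ?_⟩
  rw [AlgEquiv.symm_apply_eq]
  simp [B, QuaternionAlgebra.Basis.lift]

theorem hasSymbol_iff (h2 : (2 : K) ≠ 0) : HasSymbol K D a b ↔ Module.finrank K D = 4 ∧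
    ∃ x z : D, x * x = algebraMap K D a ∧ z * z = algebraMap K D b ∧ x * z = -(z * x) := by
  constructor
  · rintro ⟨e⟩
    refine ⟨by rw [e.toLinearEquiv.finrank_eq, QuaternionAlgebra.finrank_eq_four],
      e.symm ⟨0, 1, 0, 0⟩, e.symm ⟨0, 0, 1, 0⟩, ?_, ?_, ?_⟩
    all_goals
      apply e.injective
      simp only [map_mul, map_neg, AlgEquiv.apply_symm_apply, AlgEquiv.commutes]
      ext <;> simp
  · rintro ⟨hD, x, z, hx, hz, hxz⟩
    obtain ⟨e, -⟩ := exists_algEquiv_of_anticomm h2 hD hx hz hxz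
    exact ⟨e⟩

theorem HasSymbol.congr {D' : Type*} [Ring D'] [Algebra K D'] (h : HasSymbol K D a b)
    (e : D ≃ₐ[K] D') : HasSymbol K D' a b :=
  h.map e.symm.trans

theorem HasSymbol.baseChange (h2 : (2 : K) ≠ 0) (L : Type*) [Field L] [Algebra K L]
    (h : HasSymbol K D a b) : HasSymbol L (L ⊗[K] D) (Units.map (algebraMap K L) a)
      (Units.map (algebraMap K L) b) := by
  obtain ⟨hD, x, z, hx, hz, hxz⟩ := (hasSymbol_iff h2).mp h
  have hsmul : ∀ r : K, (1 : L) ⊗ₜ[K] algebraMap K D r = algebraMap L _ (algebraMap K L r) :=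
    fun r => by
      rw [Algebra.TensorProduct.algebraMap_apply, Algebra.algebraMap_self_apply,
        Algebra.TensorProduct.tmul_one_eq_one_tmul]
  refine (hasSymbol_iff (two_ne_zero_of_algebra h2)).mpr
    ⟨by rw [Module.finrank_baseChange, hD], 1 ⊗ₜ x, 1 ⊗ₜ z, ?_, ?_, ?_⟩
  · rw [Algebra.TensorProduct.tmul_mul_tmul, mul_one, hx, hsmul]
    rfl
  · rw [Algebra.TensorProduct.tmul_mul_tmul, mul_one, hz, hsmul]
    rfl
  · rw [Algebra.TensorProduct.tmul_mul_tmul, Algebra.TensorProduct.tmul_mul_tmul, hxz,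
      TensorProduct.tmul_neg]

theorem isQuaternionDivision_iff (h : HasSymbol K D a b) :
    IsQuaternionDivision K D ↔
      (QuadraticMap.weightedSumSquares K (normCoeff (a : K) b)).Anisotropic := by
  obtain ⟨e⟩ := id h
  rw [IsQuaternionDivision, and_iff_right ⟨a, b, h⟩, ← anisotropic_nrd_iff]
  constructor
  · intro hu q hq
    by_contra hq0
    have hqu : IsUnit q := by
      rw [← isUnit_map_iff e.symm]
      exact hu _ ((map_ne_zero_iff _ e.symm.injective).mpr hq0)
    have hstar : star q = 0 := hqu.mul_right_eq_zero.mp (by rw [mul_star_eq_nrd, hq, map_zero])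
    exact hq0 (star_eq_zero.mp hstar)
  · intro hN x hx
    have hn : nrd (a : K) b (e x) ≠ 0 := fun hn => hx ((map_eq_zero_iff _ e.injective).mp (hN _ hn))
    rw [← isUnit_map_iff e]
    refine isUnit_iff_exists.mpr ⟨star (e x) * algebraMap K _ (nrd (a : K) b (e x))⁻¹, ?_, ?_⟩
    · rw [← mul_assoc, mul_star_eq_nrd, ← map_mul, mul_inv_cancel₀ hn, map_one]
    · rw [← Algebra.commutes, mul_assoc, star_mul_eq_nrd, ← map_mul, inv_mul_cancel₀ hn, map_one]

end Symbol

section Linked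

variable {K : Type u} [Field K] {D : Type v} [Ring D] [Algebra K D]

theorem algHom_apply_mem_bot_iff {A : Type*} [Ring A] [Algebra K A] {f : D →ₐ[K] A}
    (hf : Function.Injective f) {x : D} :
    f x ∈ (⊥ : Subalgebra K A) ↔ x ∈ (⊥ : Subalgebra K D) := by
  rw [← Algebra.map_bot f, Subalgebra.mem_map]
  exact hf.mem_set_image

theorem IsQuaternionDivision.ne_zero_of_mul_self (hD : IsQuaternionDivision K D) {x : D}
    (hx : x ≠ 0) {c : K} (hxc : x * x = algebraMap K D c) : c ≠ 0 := by
  rintro rfl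
  exact hx ((hD.2 x hx).mul_left_eq_zero.mp (by rw [hxc, map_zero]))

theorem IsQuaternionDivision.exists_mul_ne (h2 : (2 : K) ≠ 0) (hD : IsQuaternionDivision K D)
    {x : D} (hx : x ∉ (⊥ : Subalgebra K D)) : ∃ w, x * w ≠ w * x := by
  obtain ⟨⟨a, b, ⟨e⟩⟩, -⟩ := hD
  by_contra! hall
  refine hx ((algHom_apply_mem_bot_iff (f := e.toAlgHom) e.injective).mp
    (mem_bot_of_forall_commute h2 a.ne_zero fun p => ?_))
  simpa [commute_iff_eq] using congrArg e (hall (e.symm p)).symm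

theorem IsQuaternionDivision.exists_algEquiv_of_sq (h2 : (2 : K) ≠ 0)
    (hD : IsQuaternionDivision K D) {x : D} (hx : x ∉ (⊥ : Subalgebra K D)) {c : Kˣ}
    (hxc : x * x = algebraMap K D c) :
    ∃ (f : Kˣ) (e : D ≃ₐ[K] ℍ[K,(c : K),0,(f : K)]), e x = ⟨0, 1, 0, 0⟩ := by
  obtain ⟨w, hw⟩ := hD.exists_mul_ne h2 hx
  obtain ⟨a, b, ⟨e⟩⟩ := hD.1
  let z := x * w - w * x
  have hz : z * z = algebraMap K D (-nrd (a : K) b (e z)) := by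
    apply e.injective
    rw [map_mul, AlgEquiv.commutes]
    exact mul_self_of_re_eq_zero (by simp [z, re_mul_comm (e x), -QuaternionAlgebra.re_mul])
  have hxz : x * z = -(z * x) := by
    rw [mul_sub, sub_mul, mul_assoc w x x, ← mul_assoc x x w, hxc, Algebra.commutes, neg_sub,
      mul_assoc]
  obtain ⟨f, hf⟩ := (hD.ne_zero_of_mul_self (sub_ne_zero.mpr hw) hz).isUnit
  have hfin : Module.finrank K D = 4 := by
    rw [e.toLinearEquiv.finrank_eq, QuaternionAlgebra.finrank_eq_four]
  exact ⟨f, exists_algEquiv_of_anticomm h2 hfin hxc (hf ▸ hz) hxz⟩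

theorem nonempty_algEquiv_centralizer (h2 : (2 : K) ≠ 0) (hD : IsQuaternionDivision K D) {x : D}
    (hx : x ∉ (⊥ : Subalgebra K D)) {c : Kˣ} (hxc : x * x = algebraMap K D c) :
    Nonempty (QuadraticAlgebra K (c : K) 0 ≃ₐ[K] Subalgebra.centralizer K {x}) := by
  obtain ⟨f, e, he⟩ := hD.exists_algEquiv_of_sq h2 hx hxc
  let ψ : QuadraticAlgebra K (c : K) 0 →ₐ[K] D := QuadraticAlgebra.lift ⟨x, by
    rw [hxc, zero_smul, add_zero, Algebra.algebraMap_eq_smul_one]⟩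
  have hψ : ∀ z, e (ψ z) = ⟨z.re, z.im, 0, 0⟩ := fun z => by
    change e (z.re • 1 + z.im • x) = _
    rw [map_add, map_smul, map_smul, map_one, he]
    ext <;> simp
  have hinj : Function.Injective ψ := fun z w hzw => by
    have h := congrArg e hzw
    rw [hψ, hψ, QuaternionAlgebra.ext_iff] at h
    exact QuadraticAlgebra.ext h.1 h.2.1
  have hrange : ψ.range = Subalgebra.centralizer K {x} := by
    ext s
    rw [AlgHom.mem_range, Subalgebra.mem_centralizer_iff]
    simp only [Set.mem_singleton_iff, forall_eq]
    constructor
    · rintro ⟨z, rfl⟩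
      apply e.injective
      rw [map_mul, map_mul, he, hψ]
      ext <;> simp
    · intro hs
      have hcomm : Commute ⟨0, 1, 0, 0⟩ (e s) := by
        rw [commute_iff_eq, ← he, ← map_mul, hs, map_mul]
      obtain ⟨hJ, hK⟩ := imJ_eq_zero_and_imK_eq_zero_of_commute h2 c.ne_zero hcomm
      exact ⟨⟨(e s).re, (e s).imI⟩, e.injective (by rw [hψ]; ext <;> simp [hJ, hK])⟩
  exact ⟨(AlgEquiv.ofInjective ψ hinj).trans (Subalgebra.equivOfEq _ _ hrange)⟩

theorem isMaximalSubfield_centralizer (h2 : (2 : K) ≠ 0) (hD : IsQuaternionDivision K D) {x : D}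
    (hx : x ∉ (⊥ : Subalgebra K D)) {c : Kˣ} (hxc : x * x = algebraMap K D c) :
    IsMaximalSubfield K (Subalgebra.centralizer K {x}) := by
  obtain ⟨e⟩ := nonempty_algEquiv_centralizer h2 hD hx hxc
  have hmem : ∀ {s : D}, s ∈ Subalgebra.centralizer K {x} ↔ Commute x s := fun {s} => by
    simp [Subalgebra.mem_centralizer_iff, commute_iff_eq]
  have : Nontrivial (Subalgebra.centralizer K {x}) := e.symm.toEquiv.nontrivial
  refine ⟨⟨exists_pair_ne _, fun s t => ?_, fun {s} hs => ?_⟩, fun S hS hle s hs => ?_⟩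
  · exact e.symm.injective (by rw [map_mul, map_mul, mul_comm])
  · obtain ⟨t, ht⟩ := hD.2 s (by simpa using hs)
    have hxt : Commute x (t : D) := ht ▸ hmem.mp s.2
    exact ⟨⟨_, hmem.mpr hxt.units_inv_right⟩, Subtype.ext (by simp [← ht])⟩
  · exact hmem.mpr (congrArg Subtype.val
      (hS.mul_comm ⟨x, hle (hmem.mpr (Commute.refl x))⟩ ⟨s, hs⟩))

theorem HasSymbol.exists_sq {a b : Kˣ} (h : HasSymbol K D a b) :
    ∃ x ∉ (⊥ : Subalgebra K D), x * x = algebraMap K D a := by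
  obtain ⟨e⟩ := h
  refine ⟨e.symm ⟨0, 1, 0, 0⟩, ?_, e.injective ?_⟩
  · rw [← AlgEquiv.coe_toAlgHom, algHom_apply_mem_bot_iff e.symm.injective]
    exact notMem_bot_of_re_eq_zero rfl (by simp [QuaternionAlgebra.ext_iff])
  · rw [map_mul, AlgEquiv.apply_symm_apply, AlgEquiv.commutes]
    ext <;> simp

theorem IsMaximalSubfield.exists_sq (h2 : (2 : K) ≠ 0) (hD : IsQuaternionDivision K D)
    {E : Subalgebra K D} (hE : IsMaximalSubfield K E) :
    ∃ x ∈ E, x ∉ (⊥ : Subalgebra K D) ∧ ∃ c : Kˣ, x * x = algebraMap K D c := by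
  obtain ⟨a, b, hab⟩ := hD.1
  obtain ⟨z, hz, hzK⟩ : ∃ z ∈ E, z ∉ (⊥ : Subalgebra K D) := by
    by_contra! hall
    obtain ⟨x, hx, hxc⟩ := hab.exists_sq
    have hC := isMaximalSubfield_centralizer h2 hD hx hxc
    refine hx (hall x (hE.2 hC.1 (le_trans hall bot_le) ?_))
    simp [Subalgebra.mem_centralizer_iff]
  obtain ⟨e⟩ := hab
  let x := z - algebraMap K D (e z).re
  have hx : x ∉ (⊥ : Subalgebra K D) := fun h =>
    hzK (by simpa [x] using add_mem h (algebraMap_mem (⊥ : Subalgebra K D) (e z).re))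
  have hxx : x * x = algebraMap K D (-nrd (a : K) b (e x)) := by
    apply e.injective
    rw [map_mul, AlgEquiv.commutes]
    exact mul_self_of_re_eq_zero (by simp [x])
  obtain ⟨c, hc⟩ := (hD.ne_zero_of_mul_self (fun h => hx (by rw [h]; exact zero_mem _)) hxx).isUnit
  exact ⟨x, E.sub_mem hz (E.algebraMap_mem _), hx, c, hc ▸ hxx⟩

variable {D' : Type v} [Ring D'] [Algebra K D']

theorem linked_iff_exists_sq (h2 : (2 : K) ≠ 0) (hD : IsQuaternionDivision K D)
    (hD' : IsQuaternionDivision K D') :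
    Linked K D D' ↔ ∃ c : Kˣ, (∃ x ∉ (⊥ : Subalgebra K D), x * x = algebraMap K D c) ∧
      ∃ x ∉ (⊥ : Subalgebra K D'), x * x = algebraMap K D' c := by
  constructor
  · rintro ⟨E, E', hE, -, ⟨ε⟩⟩
    obtain ⟨x, hxE, hx, c, hxc⟩ := hE.exists_sq h2 hD
    let f : E →ₐ[K] D' := E'.val.comp ε.toAlgHom
    have hf : Function.Injective f := Subtype.val_injective.comp ε.injective
    refine ⟨c, ⟨x, hx, hxc⟩, f ⟨x, hxE⟩, ?_, ?_⟩
    · rwa [algHom_apply_mem_bot_iff hf,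
        ← algHom_apply_mem_bot_iff (f := E.val) Subtype.val_injective]
    · rw [← map_mul, ← f.commutes]
      exact congrArg f (Subtype.ext hxc)
  · rintro ⟨c, ⟨x, hx, hxc⟩, x', hx', hxc'⟩
    obtain ⟨e⟩ := nonempty_algEquiv_centralizer h2 hD hx hxc
    obtain ⟨e'⟩ := nonempty_algEquiv_centralizer h2 hD' hx' hxc'
    exact ⟨_, _, isMaximalSubfield_centralizer h2 hD hx hxc,
      isMaximalSubfield_centralizer h2 hD' hx' hxc', ⟨e.symm.trans e'⟩⟩

theorem linked_iff_exists_hasSymbol (h2 : (2 : K) ≠ 0) (hD : IsQuaternionDivision K D)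
    (hD' : IsQuaternionDivision K D') :
    Linked K D D' ↔ ∃ c f f' : Kˣ, HasSymbol K D c f ∧ HasSymbol K D' c f' := by
  rw [linked_iff_exists_sq h2 hD hD']
  constructor
  · rintro ⟨c, ⟨x, hx, hxc⟩, x', hx', hxc'⟩
    obtain ⟨f, e, -⟩ := hD.exists_algEquiv_of_sq h2 hx hxc
    obtain ⟨f', e', -⟩ := hD'.exists_algEquiv_of_sq h2 hx' hxc'
    exact ⟨c, f, f', ⟨e⟩, ⟨e'⟩⟩
  · rintro ⟨c, f, f', h, h'⟩
    exact ⟨c, h.exists_sq, h'.exists_sq⟩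

end Linked

section Albert

open QuadraticMap

/-- The coefficients of the Albert form of the quaternion algebras with Hilbert symbols `(a, b)` and
`(a', b')`: it is the difference of the norm forms, restricted to the pure quaternions. -/
def albertCoeff {R : Type*} [CommRing R] (a b a' b' : R) : Fin 6 → R :=
  ![-a, -b, a * b, a', b', -(a' * b')]

theorem albertCoeff_ne_zero {K : Type u} [Field K] (a b a' b' : Kˣ) (i : Fin 6) :
    albertCoeff (a : K) b a' b' i ≠ 0 := by
  fin_cases i <;> simp [albertCoeff]

theorem algebraMap_comp_albertCoeff {K R : Type*} [CommRing K] [CommRing R] [Algebra K R]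
    (a b a' b' : K) : algebraMap K R ∘ albertCoeff a b a' b' =
      albertCoeff (algebraMap K R a) (algebraMap K R b) (algebraMap K R a')
        (algebraMap K R b') := by
  ext i
  fin_cases i <;> simp [albertCoeff]

variable {K : Type u} [Field K] {D : Type v} [Ring D] [Algebra K D] {D' : Type v} [Ring D']
  [Algebra K D'] {a b a' b' : Kˣ}

theorem linked_of_nrd_eq (h2 : (2 : K) ≠ 0) (hD : IsQuaternionDivision K D)
    (hD' : IsQuaternionDivision K D') (h : HasSymbol K D a b) (h' : HasSymbol K D' a' b')
    {q : ℍ[K,(a : K),0,(b : K)]} {q' : ℍ[K,(a' : K),0,(b' : K)]} (hq : q.re = 0) (hq' : q'.re = 0)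
    (hn0 : nrd (a : K) b q ≠ 0) (hn : nrd (a : K) b q = nrd (a' : K) b' q') : Linked K D D' := by
  have hsq : ∀ {A : Type v} [Ring A] [Algebra K A] {c d : Kˣ} {p : ℍ[K,(c : K),0,(d : K)]},
      HasSymbol K A c d → p.re = 0 → nrd (c : K) d p ≠ 0 →
      ∃ x ∉ (⊥ : Subalgebra K A), x * x = algebraMap K A (-nrd (c : K) d p) := by
    rintro A _ _ c d p ⟨e⟩ hp hp0
    refine ⟨e.symm p, ?_, e.injective ?_⟩
    · rw [← AlgEquiv.coe_toAlgHom, algHom_apply_mem_bot_iff e.symm.injective]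
      refine notMem_bot_of_re_eq_zero hp fun h0 => hp0 (by rw [h0, map_zero])
    · rw [map_mul, AlgEquiv.apply_symm_apply, AlgEquiv.commutes, mul_self_of_re_eq_zero hp]
  refine (linked_iff_exists_sq h2 hD hD').mpr
    ⟨Units.mk0 _ (neg_ne_zero.mpr hn0), hsq h hq hn0, ?_⟩
  simpa only [Units.val_mk0, hn] using hsq h' hq' (hn ▸ hn0)

theorem linked_of_albert_eq_zero (h2 : (2 : K) ≠ 0) (hD : IsQuaternionDivision K D)
    (hD' : IsQuaternionDivision K D') (h : HasSymbol K D a b) (h' : HasSymbol K D' a' b')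
    {v : Fin 6 → K} (hv0 : v ≠ 0)
    (hv : weightedSumSquares K (albertCoeff (a : K) b a' b') v = 0) : Linked K D D' := by
  let q : ℍ[K,(a : K),0,(b : K)] := ⟨0, v 0, v 1, v 2⟩
  let q' : ℍ[K,(a' : K),0,(b' : K)] := ⟨0, v 3, v 4, v 5⟩
  have hn : nrd (a : K) b q = nrd (a' : K) b' q' := by
    simp only [weightedSumSquares_apply, Fin.sum_univ_six, albertCoeff, Matrix.cons_val,
      smul_eq_mul] at hv
    simp only [nrd_apply, q, q']
    linear_combination hv
  refine linked_of_nrd_eq h2 hD hD' h h' (q := q) (q' := q') rfl rfl (fun hn0 => hv0 ?_) hn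
  have hq := anisotropic_nrd_iff.mpr ((isQuaternionDivision_iff h).mp hD) q hn0
  have hq' := anisotropic_nrd_iff.mpr ((isQuaternionDivision_iff h').mp hD') q' (hn ▸ hn0)
  rw [QuaternionAlgebra.ext_iff] at hq hq'
  ext i
  fin_cases i
  exacts [hq.2.1, hq.2.2.1, hq.2.2.2, hq'.2.1, hq'.2.2.1, hq'.2.2.2]

end Albert

section Isometric

open QuadraticMap

variable {K : Type u} [Field K]

theorem exists_eq_mul_of_normForm_equivalent (h2 : (2 : K) ≠ 0) {α β γ : Kˣ}
    (hγ : (normForm α γ).Anisotropic) (h : (normForm α β).Equivalent (normForm α γ)) :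
    ∃ s t : K, (β : K) = γ * (s ^ 2 - α * t ^ 2) := by
  obtain ⟨g⟩ := h
  let e (i : Fin 4) : Fin 4 → K := Pi.single i 1
  have horth (x y : Kˣ) {i j : Fin 4} (hij : i ≠ j) : polar (normForm x y) (e i) (e j) = 0 := by
    rw [normForm, polar_weightedSumSquares_single]
    simp [e, hij]
  obtain ⟨τ, hτ0, hτ1⟩ := exists_isometry_apply_eq_and_apply_eq hγ (u := g (e 0)) (v := g (e 1))
    (u' := e 0) (v' := e 1)
    ((g.map_app _).trans (by simp only [normForm, weightedSumSquares_single, e, Matrix.cons_val]))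
    ((g.map_app _).trans (by simp only [normForm, weightedSumSquares_single, e, Matrix.cons_val]))
    ((polar_isometry_apply g.toIsometry _ _).trans
      ((horth _ _ (by decide)).trans (horth _ _ (by decide)).symm))
  let f := τ.comp g.toIsometry
  have hcoord {i : Fin 4} (hi : i ≠ 2) (hfi : f (e i) = e i)
      (hc : normCoeff (α : K) γ i ≠ 0) : f (e 2) i = 0 := by
    have h0 := (polar_isometry_apply f (e i) (e 2)).trans (horth _ _ hi)
    rw [hfi] at h0
    simpa [h2, hc] using (polar_weightedSumSquares_single (normCoeff (α : K) γ) i _).symm.trans h0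
  have hw0 : f (e 2) 0 = 0 := hcoord (by decide) hτ0 (by simp [normCoeff])
  have hw1 : f (e 2) 1 = 0 := hcoord (by decide) hτ1 (by simp [normCoeff])
  have hw : weightedSumSquares K (normCoeff (α : K) γ) (f (e 2)) = -β :=
    (f.map_app _).trans (weightedSumSquares_single _ _)
  simp only [normCoeff, weightedSumSquares_apply, smul_eq_mul, Fin.sum_univ_four, Matrix.cons_val,
    hw0, hw1] at hw
  exact ⟨f (e 2) 2, f (e 2) 3, by linear_combination hw⟩

theorem HasSymbol.normForm_equivalent (h2 : (2 : K) ≠ 0) {D : Type v} [Ring D] [Algebra K D]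
    {a b a' b' : Kˣ} (h : HasSymbol K D a b) (h' : HasSymbol K D a' b') :
    (normForm a b).Equivalent (normForm a' b') := by
  obtain ⟨e⟩ := h
  obtain ⟨e'⟩ := h'
  let f := e.symm.trans e'
  have hf : (nrd (a : K) b).Equivalent (nrd (a' : K) b') :=
    ⟨⟨f.toLinearEquiv, nrd_algHom h2 a.ne_zero b.ne_zero f.toAlgHom⟩⟩
  exact ((equivalent_nrd_weightedSumSquares _ _).symm.trans hf).trans
    (equivalent_nrd_weightedSumSquares _ _)

variable {D D' : Type v} [Ring D] [Algebra K D] [Ring D'] [Algebra K D'] {α β γ : Kˣ}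

theorem HasSymbol.of_eq_mul (h2 : (2 : K) ≠ 0) (h : HasSymbol K D α γ) {s t : K}
    (hβ : (β : K) = γ * (s ^ 2 - α * t ^ 2)) : HasSymbol K D α β := by
  have hA : HasSymbol K ℍ[K,(α : K),0,(γ : K)] α γ := ⟨AlgEquiv.refl⟩
  let z : ℍ[K,(α : K),0,(γ : K)] := ⟨0, 0, s, t⟩
  have hz : z * z = algebraMap K _ (β : K) := by
    rw [QuaternionAlgebra.algebraMap_eq, hβ]
    ext <;> simp [z] <;> ring
  exact HasSymbol.congr ((hasSymbol_iff h2).mpr ⟨((hasSymbol_iff h2).mp hA).1, ⟨0, 1, 0, 0⟩, z,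
    by rw [QuaternionAlgebra.algebraMap_eq]; ext <;> simp, hz, by ext <;> simp [z]⟩) h.some.symm

theorem isometric_iff_exists_eq_mul (h2 : (2 : K) ≠ 0) (h : HasSymbol K D α β)
    (h' : HasSymbol K D' α γ) (hD' : IsQuaternionDivision K D') :
    Isometric K D D' ↔ ∃ s t : K, (β : K) = γ * (s ^ 2 - α * t ^ 2) := by
  constructor
  · rintro ⟨a, b, a', b', hab, hab', hequiv⟩
    exact exists_eq_mul_of_normForm_equivalent h2 ((isQuaternionDivision_iff h').mp hD')
      ((h.normForm_equivalent h2 hab).trans (hequiv.trans (hab'.normForm_equivalent h2 h')))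
  · rintro ⟨s, t, hβ⟩
    exact ⟨α, β, α, β, h, h'.of_eq_mul h2 hβ, .refl _⟩

theorem anisotropic_normCoeff_mul_iff
    (hγ : (weightedSumSquares K (normCoeff (α : K) γ)).Anisotropic) :
    (weightedSumSquares K (normCoeff (α : K) (β * γ))).Anisotropic ↔
      ∀ s t : K, (β : K) ≠ γ * (s ^ 2 - α * t ^ 2) := by
  have hα (s t : K) (hst : s ^ 2 - α * t ^ 2 = 0) : s = 0 ∧ t = 0 := by
    have := hγ ![s, t, 0, 0] (by
      simp only [normCoeff, weightedSumSquares_apply, smul_eq_mul, Fin.sum_univ_four,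
        Matrix.cons_val]
      linear_combination hst)
    exact ⟨congrFun this 0, congrFun this 1⟩
  constructor
  · intro haniso s t hβ
    refine one_ne_zero (congrFun (haniso ![γ * s, γ * t, 1, 0] ?_) 2)
    simp only [normCoeff, weightedSumSquares_apply, smul_eq_mul, Fin.sum_univ_four, Matrix.cons_val]
    linear_combination -γ * hβ
  · intro hβ v hv
    simp only [normCoeff, weightedSumSquares_apply, smul_eq_mul, Fin.sum_univ_four,
      Matrix.cons_val] at hv
    have hn : v 2 ^ 2 - α * v 3 ^ 2 = 0 := by
      by_contra hn
      refine hβ ((v 0 * v 2 - α * v 1 * v 3) / (γ * (v 2 ^ 2 - α * v 3 ^ 2)))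
        ((v 1 * v 2 - v 0 * v 3) / (γ * (v 2 ^ 2 - α * v 3 ^ 2))) ?_
      field_simp
      linear_combination (-(v 2 ^ 2 - α * v 3 ^ 2)) * hv
    obtain ⟨h0, h1⟩ := hα (v 0) (v 1) (by linear_combination hv + β * γ * hn)
    obtain ⟨h2, h3⟩ := hα _ _ hn
    ext i
    fin_cases i <;> assumption

theorem isometric_iff_not_anisotropic (h2 : (2 : K) ≠ 0) (h : HasSymbol K D α β)
    (h' : HasSymbol K D' α γ) (hD' : IsQuaternionDivision K D') :
    Isometric K D D' ↔ ¬ (weightedSumSquares K (normCoeff (α : K) (β * γ))).Anisotropic := by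
  rw [isometric_iff_exists_eq_mul h2 h h' hD',
    anisotropic_normCoeff_mul_iff ((isQuaternionDivision_iff h').mp hD')]
  push Not
  rfl

end Isometric

section BaseChange

open QuadraticMap

variable {F L : Type*} [Field F] [Field L] [Algebra F L] {D D' : Type v} [Ring D] [Algebra F D]
  [Ring D'] [Algebra F D']

theorem isQuaternionDivision_tensor_iff (h2 : (2 : F) ≠ 0) {a b : Fˣ} (h : HasSymbol F D a b) :
    IsQuaternionDivision L (L ⊗[F] D) ↔
      (weightedSumSquares L (normCoeff (a : F) b)).Anisotropic := by
  rw [isQuaternionDivision_iff (h.baseChange h2 L),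
    ← weightedSumSquares_algebraMap (K := F) (M := L), algebraMap_comp_normCoeff]
  rfl

theorem IsQuaternionDivision.tensor (h2 : (2 : F) ≠ 0) (hL : ∀ a b : F,
      (weightedSumSquares F (normCoeff a b)).Anisotropic →
        (weightedSumSquares L (normCoeff a b)).Anisotropic)
    (hD : IsQuaternionDivision F D) : IsQuaternionDivision L (L ⊗[F] D) := by
  obtain ⟨a, b, h⟩ := hD.1
  exact (isQuaternionDivision_tensor_iff h2 h).mpr (hL _ _ ((isQuaternionDivision_iff h).mp hD))

theorem not_isometric_tensor (h2 : (2 : F) ≠ 0) (hL : ∀ a b : F,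
      (weightedSumSquares F (normCoeff a b)).Anisotropic →
        (weightedSumSquares L (normCoeff a b)).Anisotropic)
    (hD : IsQuaternionDivision F D) (hD' : IsQuaternionDivision F D') (hl : Linked F D D')
    (hi : ¬ Isometric F D D') : ¬ Isometric L (L ⊗[F] D) (L ⊗[F] D') := by
  obtain ⟨α, β, γ, h, h'⟩ := (linked_iff_exists_hasSymbol h2 hD hD').mp hl
  rw [isometric_iff_not_anisotropic h2 h h' hD', not_not] at hi
  rw [isometric_iff_not_anisotropic (two_ne_zero_of_algebra h2) (h.baseChange h2 L)
    (h'.baseChange h2 L) (hD'.tensor h2 hL), not_not]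
  have := hL _ _ hi
  rwa [← weightedSumSquares_algebraMap (M := L), algebraMap_comp_normCoeff, map_mul] at this

end BaseChange

section UnlinkedPairs

open QuadraticMap

variable {F : Type u} [Field F]

/-- The isometry `q_D ⊥ -q_D' ≅ φ ⊥ ⟨1, -1⟩`, with `φ` the Albert form, as a permutation of the
coordinates. -/
def albertEquiv (F : Type u) [Field F] :
    ((Fin 4 → F) × (Fin 4 → F)) ≃ₗ[F] ((Fin 6 → F) × (Fin 2 → F)) where
  toFun v := (![v.1 1, v.1 2, v.1 3, v.2 1, v.2 2, v.2 3], ![v.1 0, v.2 0])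
  invFun v := (![v.2 0, v.1 0, v.1 1, v.1 2], ![v.2 1, v.1 3, v.1 4, v.1 5])
  map_add' u v := by
    ext i <;> fin_cases i <;> rfl
  map_smul' r v := by
    ext i <;> fin_cases i <;> rfl
  left_inv v := by
    ext i <;> fin_cases i <;> rfl
  right_inv v := by
    ext i <;> fin_cases i <;> rfl

theorem prod_normForm_equivalent_albert (a b a' b' : Fˣ) :
    (QuadraticMap.prod (normForm a b) (-normForm a' b')).Equivalent
      (QuadraticMap.prod (weightedSumSquares F (albertCoeff (a : F) b a' b'))
        (weightedSumSquares F ![(1 : F), -1])) := by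
  refine ⟨{ albertEquiv F with map_app' := fun v => ?_ }⟩
  change QuadraticMap.prod _ _ (albertEquiv F v) = _
  simp only [QuadraticMap.prod_apply, _root_.neg_apply, normForm, weightedSumSquares_apply,
    Fin.sum_univ_four, Fin.sum_univ_six, Fin.sum_univ_two, albertEquiv, albertCoeff,
    LinearEquiv.coe_mk, LinearMap.coe_mk, AddHom.coe_mk, Matrix.cons_val, smul_eq_mul]
  ring

/-- The coefficients of the Albert forms of the unlinked pairs. -/
noncomputable def pairCoeff (p : UnlinkedPair F) : Fin 6 → F :=
  albertCoeff (p.1.1.symbol.1 : F) p.1.1.symbol.2 p.1.2.symbol.1 p.1.2.symbol.2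

theorem pairCoeff_ne_zero (p : UnlinkedPair F) (i : Fin 6) : pairCoeff p i ≠ 0 :=
  albertCoeff_ne_zero _ _ _ _ i

theorem Quat.hasSymbol_alg (D : Quat F) : HasSymbol F D.Alg D.symbol.1 D.symbol.2 :=
  ⟨AlgEquiv.refl⟩

theorem isAnisotropicPart_pairCoeff (h2 : (2 : F) ≠ 0) (p : UnlinkedPair F) :
    IsAnisotropicPart p.1.1 p.1.2 (weightedSumSquares F (pairCoeff p)) := by
  refine ⟨fun v hv => ?_, prod_normForm_equivalent_albert _ _ _ _⟩
  by_contra hv0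
  exact p.2.2.2 (linked_of_albert_eq_zero h2 p.2.1 p.2.2.1 p.1.1.hasSymbol_alg
    p.1.2.hasSymbol_alg hv0 hv)

theorem exists_quat {D : Type v} [Ring D] [Algebra F D] (hD : IsQuaternion F D) :
    ∃ Q : Quat F, HasSymbol F D Q.symbol.1 Q.symbol.2 := by
  obtain ⟨a, b, ⟨e⟩⟩ := hD
  let Q : Quat F := Quotient.mk (symbolSetoid F) (a, b)
  have hQ : HasSymbol F ℍ[F,(a : F),0,(b : F)] Q.symbol.1 Q.symbol.2 :=
    (symbolSetoid F).symm (Quotient.mk_out (s := symbolSetoid F) (a, b))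
  exact ⟨Q, hQ.congr e.symm⟩

theorem exists_unlinkedPair (h2 : (2 : F) ≠ 0) {D D' : Type v} [Ring D] [Algebra F D] [Ring D']
    [Algebra F D'] (hD : IsQuaternionDivision F D) (hD' : IsQuaternionDivision F D')
    (h : ¬ Linked F D D') : ∃ p : UnlinkedPair F, HasSymbol F D p.1.1.symbol.1 p.1.1.symbol.2 ∧
      HasSymbol F D' p.1.2.symbol.1 p.1.2.symbol.2 := by
  obtain ⟨Q, hQ⟩ := exists_quat hD.1
  obtain ⟨Q', hQ'⟩ := exists_quat hD'.1
  have hA : IsQuaternionDivision F Q.Alg :=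
    (isQuaternionDivision_iff Q.hasSymbol_alg).mpr ((isQuaternionDivision_iff hQ).mp hD)
  have hA' : IsQuaternionDivision F Q'.Alg :=
    (isQuaternionDivision_iff Q'.hasSymbol_alg).mpr ((isQuaternionDivision_iff hQ').mp hD')
  refine ⟨⟨(Q, Q'), hA, hA', fun hl => h ?_⟩, hQ, hQ'⟩
  obtain ⟨c, f, f', hf, hf'⟩ := (linked_iff_exists_hasSymbol h2 hA hA').mp hl
  exact (linked_iff_exists_hasSymbol h2 hD hD').mpr
    ⟨c, f, f', hf.congr hQ.some.symm, hf'.congr hQ'.some.symm⟩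

end UnlinkedPairs

namespace GenericZeros

open QuadraticMap

variable {F L : Type u} [Field F] [Field L] [Algebra F L]

theorem isLinkingExtension (h2 : (2 : F) ≠ 0) (G : GenericZeros F L (pairCoeff (F := F))) :
    IsLinkingExtension F L := by
  intro D D' _ _ _ _ hD hD' hDL hDL'
  have h2L : (2 : L) ≠ 0 := two_ne_zero_of_algebra h2
  by_cases hl : Linked F D D'
  · obtain ⟨c, f, f', h, h'⟩ := (linked_iff_exists_hasSymbol h2 hD hD').mp hl
    exact (linked_iff_exists_hasSymbol h2L hDL hDL').mpr
      ⟨_, _, _, h.baseChange h2 L, h'.baseChange h2 L⟩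
  · obtain ⟨p, h, h'⟩ := exists_unlinkedPair h2 hD hD' hl
    have hzero := G.weightedSumSquares_coords (pairCoeff_ne_zero p 0)
    rw [← weightedSumSquares_algebraMap (M := L), pairCoeff, algebraMap_comp_albertCoeff] at hzero
    exact linked_of_albert_eq_zero h2L hDL hDL' (h.baseChange h2 L) (h'.baseChange h2 L)
      (fun h0 => G.coords_succ_ne_zero p 0 (congrFun h0 _)) hzero

theorem isFunctionFieldTower (h2 : (2 : F) ≠ 0) (G : GenericZeros F L (pairCoeff (F := F)))
    (htop : G.field Set.univ = ⊤) : IsFunctionFieldTower F L := by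
  let below (p : UnlinkedPair F) : Set (UnlinkedPair F) := {p' | WellOrderingRel p' p}
  refine ⟨WellOrderingRel, fun p => weightedSumSquares F (pairCoeff p),
    fun p => G.field (insert p (below p)), inferInstance, isAnisotropicPart_pairCoeff h2,
    fun p => ?_, ?_⟩
  · have hp : p ∉ below p := irrefl_of WellOrderingRel p
    refine G.exists_algEquiv_bigFunctionField h2 pairCoeff_ne_zero (by norm_num) hp ?_ rfl
    exact G.iSup_field (below p) (fun q => insert q (below q)) (fun q _ => Set.mem_insert _ _)
      fun q hq => Set.insert_subset hq fun r hr => trans_of WellOrderingRel hr hq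
  · rw [← htop, ← G.iSup_field Set.univ (fun p => insert p (below p))
      (fun p _ => Set.mem_insert _ _) fun _ _ => Set.subset_univ _]
    exact ((Equiv.Set.univ _).iSup_congr fun _ => rfl).symm

end GenericZeros

end Linking

theorem proposition4p1 (F : Type u) [Field F] (hF : ringChar F ≠ 2) :
    ∃ (L : Type u) (_ : Field L) (_ : Algebra F L),
      Linking.IsLinkingExtension F L ∧
      (∀ (D D' : Type u) [Ring D] [Algebra F D] [Ring D'] [Algebra F D'],
        Linking.IsQuaternionDivision F D → Linking.IsQuaternionDivision F D' →
        Linking.Linked F D D' → ¬ Linking.Isometric F D D' →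
        Linking.IsQuaternionDivision L (L ⊗[F] D) ∧
        Linking.IsQuaternionDivision L (L ⊗[F] D') ∧
        ¬ Linking.Isometric L (L ⊗[F] D) (L ⊗[F] D')) ∧
      Linking.IsFunctionFieldTower F L := by
  have h2 : (2 : F) ≠ 0 := Ring.two_ne_zero hF
  obtain ⟨L, _, _, G, htop⟩ := Linking.exists_genericZeros (Linking.pairCoeff (F := F))
  have hL := fun a b ha => G.anisotropic_of_field_univ_eq_top h2 Linking.pairCoeff_ne_zero
    (a := a) (b := b) (by norm_num) ha htop
  exact ⟨L, inferInstance, inferInstance, G.isLinkingExtension h2,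
    fun D D' _ _ _ _ hD hD' hl hi => ⟨hD.tensor h2 hL, hD'.tensor h2 hL,
      Linking.not_isometric_tensor h2 hL hD hD' hl hi⟩,
    G.isFunctionFieldTower h2 htop⟩
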